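/- **Setting.** Let $\Sigma\in\mathbb R^{d\times d}$ be positive definite, $\theta\in\mathbb R^d$, $\sigma>0$. There are $m$ agents. Agent $i$ observes $d_i$ of the $d$ features: a permutation matrix $\Pi_i$ with row blocks $\Pi_{i+}\in\mathbb R^{d_i\times d}$ and $\Pi_{i-}\in\mathbb R^{(d-d_i)\times d}$ lists its observed and unobserved features, and every feature is observed by at least one agent. Write $v_{i+}=\Pi_{i+}v$, $v_{i-}=\Pi_{i-}v$, and $\Sigma_{i+}=\Pi_{i+}\Sigma\Pi_{i+}^\top$, $\Sigma_{i\pm}=\Pi_{i+}\Sigma\Pi_{i-}^\top$, $\Sigma_{i\mp}=\Pi_{i-}\Sigma\Pi_{i+}^\top$. Put $$T_i=\begin{bmatrix} I_{d_i} & \Sigma_{i+}^{-1}\Sigma_{i\pm}\end{bmatrix}\Pi_i,\qquad z_{i}=x_{i-}-\Sigma_{i\mp}\Sigma_{i+}^{-1}x_{i+},$$ $$W_i^\star=\Sigma_{i+}\big(\mathbb E[x_{i+}\theta_{i-}^\top z_{i}z_{i}^\top\theta_{i-}x_{i+}^\top]+\sigma^2\Sigma_{i+}\big)^{-1}\Sigma_{i+},\qquad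 C^\star=\Big(\sum_{i=1}^m T_i^\top W_i^\star T_i\Big)^{-1},$$ where $x$ has the common law of the feature vectors, which has mean $0$ and covariance $\Sigma$ and is such that the expectations in the $W_i^\star$ are finite. For each agent $i$ there is an infinite sequence of samples; all feature vectors (over agents and samples) are i.i.d. with this law, all noise variables are i.i.d. $\mathsf N(0,\sigma^2)$, and features and noise are independent. From its first $n$ samples agent $i$ has the feature matrix $X_i\in\mathbb R^{n\times d}$, of which it sees $X_{i+}=X_i\Pi_{i+}^\top$, and the labels $y_i=X_i\theta+\xi_i$. With $A^\dagger$ the Moore–Penrose inverse and $\|v\|_W^2=v^\top Wv$, define $$\hat\theta_i=X_{i+}^\dagger y_i,\qquad \hat\theta_i^{\mathrm{imp}}=(T_i^\top X_{i+}^\top X_{i+}T_i)^\dagger T_i^\top X_{i+}^\top y_i,$$ $$\hat\theta^{\mathrm{imp}}(W_1,\dots,W_m)=\operatorname*{argmin}_{t\in\mathbb R^d}\sum_{i=1}^m\big\|P_it-\hat\theta_i^{\mathrm{imp}}\big\|_{W_i}^2,\qquad P_i=T_i^\top(T_iT_i^\top)^{-1}T_i .$$ Call weights $W_1,\dots,W_m\in\mathbb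 R^{d\times d}$ *admissible* if they are symmetric positive semidefinite and $\sum_i P_i^\top W_iP_i\succ0$ (so that the minimizer is unique). **Theorem.** 1. Whenever $\operatorname{rank}X_{i+}=d_i$, $$\hat\theta_i^{\mathrm{imp}}=T_i^\top(T_iT_i^\top)^{-1}\hat\theta_i .$$ For each $i$, almost surely, this rank condition, and hence the identity, holds for all sufficiently large $n$. 2. All positive definite weights are admissible, and so are the weights $T_i^\top W_i^\star T_i$; moreover $\sum_i T_i^\top W_i^\star T_i\succ0$, so $C^\star$ is well defined. 3. There is a function $C^{\mathrm{imp}}$ of the weights such that for all admissible $W_1,\dots,W_m$: the minimizer $\hat\theta^{\mathrm{imp}}=\hat\theta^{\mathrm{imp}}(W_1,\dots,W_m)$ exists and is unique for every $n$ and every realization of the data; as $n\to\infty$, $\hat\theta^{\mathrm{imp}}\to\theta$ in probability and $$\sqrt n\,\big(\hat\theta^{\mathrm{imp}}-\theta\big)\xrightarrow{d}\mathsf N\big(0,C^{\mathrm{imp}}(W_1,\dots,W_m)\big);$$ the matrix $C^{\mathrm{imp}}(W_1,\dots,W_m)$ is positive semidefinite, and $C^{\mathrm{imp}}(W_1,\dots,W_m)\succeq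 C^\star$ in the p.s.d. order. Equality holds for $W_i=T_i^\top W_i^\star T_i$, $i=1,\dots,m$. -/

import Mathlib

open Matrix MeasureTheory ProbabilityTheory Filter
open scoped Topology

namespace CollabLS

/-! ### Moore–Penrose inverse -/

/-- `B` satisfies the four Penrose equations for the real matrix `A`. -/
structure IsMoorePenrose {k l : Type*} [Fintype k] [Fintype l]
    (A : Matrix k l ℝ) (B : Matrix l k ℝ) : Prop where
  mul_mul_self : A * B * A = A
  mul_mul_inv : B * A * B = B
  symm_left : (A * B)ᵀ = A * B
  symm_right : (B * A)ᵀ = B * A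

theorem IsMoorePenrose.unique {k l : Type*} [Fintype k] [Fintype l]
    {A : Matrix k l ℝ} {B C : Matrix l k ℝ} (hB : IsMoorePenrose A B)
    (hC : IsMoorePenrose A C) : B = C := by
  have h1 : A * B = A * C := by
    calc A * B = (A * C * A) * B := by rw [hC.mul_mul_self]
      _ = (A * C) * (A * B) := by simp only [Matrix.mul_assoc]
      _ = (A * C)ᵀ * (A * B)ᵀ := by rw [hC.symm_left, hB.symm_left]
      _ = ((A * B * A) * C)ᵀ := by rw [← Matrix.transpose_mul]; simp only [Matrix.mul_assoc]
      _ = A * C := by rw [hB.mul_mul_self, hC.symm_left]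
  have h2 : B * A = C * A := by
    calc B * A = B * (A * C * A) := by rw [hC.mul_mul_self]
      _ = (B * A) * (C * A) := by simp only [Matrix.mul_assoc]
      _ = (B * A)ᵀ * (C * A)ᵀ := by rw [hC.symm_right, hB.symm_right]
      _ = (C * (A * B * A))ᵀ := by rw [← Matrix.transpose_mul]; simp only [Matrix.mul_assoc]
      _ = C * A := by rw [hB.mul_mul_self, hC.symm_right]
  calc B = B * A * B := hB.mul_mul_inv.symm
    _ = C * (A * B) := by rw [h2, Matrix.mul_assoc]
    _ = C * A * C := by rw [h1, Matrix.mul_assoc]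
    _ = C := hC.mul_mul_inv

theorem exists_isMoorePenrose {k l : Type*} [Fintype k] [Fintype l] [DecidableEq l]
    (A : Matrix k l ℝ) : ∃ B, IsMoorePenrose A B := by
  obtain ⟨R, h1, h2, h3, h4⟩ : ∃ R : Matrix l l ℝ, (Aᵀ * A) * R * (Aᵀ * A) = Aᵀ * A ∧
      R * (Aᵀ * A) * R = R ∧ Rᵀ = R ∧ (R * (Aᵀ * A))ᵀ = R * (Aᵀ * A) := by
    have hS : (Aᵀ * A).IsHermitian := by
      simpa using Matrix.isHermitian_conjTranspose_mul_self A
    set U : Matrix l l ℝ := (hS.eigenvectorUnitary : Matrix l l ℝ) with hU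
    have hUU : Uᵀ * U = 1 := by
      have := Unitary.coe_star_mul_self hS.eigenvectorUnitary
      simpa [Matrix.star_eq_conjTranspose] using this
    have hs : Aᵀ * A = U * diagonal hS.eigenvalues * Uᵀ := by
      have := hS.spectral_theorem
      simpa [Unitary.conjStarAlgAut_apply, Matrix.star_eq_conjTranspose, Function.comp_def]
        using this
    have key : ∀ a b : l → ℝ, (U * diagonal a * Uᵀ) * (U * diagonal b * Uᵀ)
        = U * diagonal (fun i => a i * b i) * Uᵀ := by
      intro a b
      calc (U * diagonal a * Uᵀ) * (U * diagonal b * Uᵀ)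
          = U * diagonal a * (Uᵀ * U) * (diagonal b * Uᵀ) := by simp only [Matrix.mul_assoc]
        _ = U * (diagonal a * diagonal b) * Uᵀ := by
            rw [hUU]; simp only [Matrix.mul_assoc, Matrix.one_mul]
        _ = _ := by rw [diagonal_mul_diagonal]
    generalize hS.eigenvalues = e at hs
    clear_value U
    clear hU hS
    refine ⟨U * diagonal (fun i => (e i)⁻¹) * Uᵀ, ?_, ?_, ?_, ?_⟩
    · rw [hs, key, key]
      simp only [mul_inv_mul_cancel]
    · rw [hs, key, key]
      congr 3
      funext i
      by_cases h : e i = 0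
      · simp [h]
      · field_simp
    · simp [Matrix.mul_assoc]
    · rw [hs, key]
      simp [Matrix.mul_assoc]
  have hA : A * R * (Aᵀ * A) = A := by
    rw [← sub_eq_zero]
    rw [← Matrix.conjTranspose_mul_self_eq_zero]
    have e : A * R * (Aᵀ * A) - A = A * (R * (Aᵀ * A) - 1) := by
      rw [Matrix.mul_sub, Matrix.mul_one, Matrix.mul_assoc]
    have z : (Aᵀ * A) * (R * (Aᵀ * A) - 1) = 0 := by
      rw [Matrix.mul_sub, Matrix.mul_one, ← Matrix.mul_assoc, h1, sub_self]
    rw [e, Matrix.conjTranspose_eq_transpose_of_trivial, Matrix.transpose_mul, Matrix.mul_assoc,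
      ← Matrix.mul_assoc Aᵀ A, z, Matrix.mul_zero]
  refine ⟨R * Aᵀ, ⟨?_, ?_, ?_, ?_⟩⟩
  · simpa only [Matrix.mul_assoc] using hA
  · calc R * Aᵀ * A * (R * Aᵀ) = (R * (Aᵀ * A) * R) * Aᵀ := by simp only [Matrix.mul_assoc]
      _ = R * Aᵀ := by rw [h2]
  · simp [Matrix.transpose_mul, h3, Matrix.mul_assoc]
  · rw [Matrix.mul_assoc]; exact h4

/-- The Moore–Penrose inverse `A†` of a real matrix. -/
noncomputable def pinv {k l : Type*} [Fintype k] [Fintype l] [DecidableEq l]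
    (A : Matrix k l ℝ) : Matrix l k ℝ :=
  (exists_isMoorePenrose A).choose

theorem pinv_spec {k l : Type*} [Fintype k] [Fintype l] [DecidableEq l]
    (A : Matrix k l ℝ) : IsMoorePenrose A (pinv A) :=
  (exists_isMoorePenrose A).choose_spec

/-! ### Views of the agents -/

/-- The view of an agent: a permutation of the `d` features listing first the `obs` observed
and then the `unobs` unobserved ones. -/
structure View (d : ℕ) where
  obs : ℕ
  unobs : ℕ
  perm : Fin obs ⊕ Fin unobs ≃ Fin d

namespace View

variable {d : ℕ} (V : View d)

/-- `Π₊`, selecting the observed features. -/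
def Pplus : Matrix (Fin V.obs) (Fin d) ℝ :=
  Matrix.of fun a j => if V.perm (Sum.inl a) = j then 1 else 0

/-- `Π₋`, selecting the unobserved features. -/
def Pminus : Matrix (Fin V.unobs) (Fin d) ℝ :=
  Matrix.of fun a j => if V.perm (Sum.inr a) = j then 1 else 0

/-- The permutation matrix `Π`, with blocks `Π₊` on top of `Π₋`. -/
def P : Matrix (Fin V.obs ⊕ Fin V.unobs) (Fin d) ℝ := Matrix.fromRows V.Pplus V.Pminus

/-- `S₊ = Π₊ S Π₊ᵀ` -/
def blockPlus (S : Matrix (Fin d) (Fin d) ℝ) : Matrix (Fin V.obs) (Fin V.obs) ℝ :=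
  V.Pplus * S * V.Pplusᵀ

/-- `S± = Π₊ S Π₋ᵀ` -/
def blockPlusMinus (S : Matrix (Fin d) (Fin d) ℝ) : Matrix (Fin V.obs) (Fin V.unobs) ℝ :=
  V.Pplus * S * V.Pminusᵀ

/-- `S∓ = Π₋ S Π₊ᵀ` -/
def blockMinusPlus (S : Matrix (Fin d) (Fin d) ℝ) : Matrix (Fin V.unobs) (Fin V.obs) ℝ :=
  V.Pminus * S * V.Pplusᵀ

/-- `T = [I, Σ₊⁻¹ Σ±] Π` -/
noncomputable def T (S : Matrix (Fin d) (Fin d) ℝ) : Matrix (Fin V.obs) (Fin d) ℝ :=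
  Matrix.fromCols (1 : Matrix (Fin V.obs) (Fin V.obs) ℝ)
    ((V.blockPlus S)⁻¹ * V.blockPlusMinus S) * V.P

/-- `Tᵀ (T Tᵀ)⁻¹` -/
noncomputable def Tlift (S : Matrix (Fin d) (Fin d) ℝ) : Matrix (Fin d) (Fin V.obs) ℝ :=
  (V.T S)ᵀ * (V.T S * (V.T S)ᵀ)⁻¹

/-- The residual `z = x₋ - Σ∓ Σ₊⁻¹ x₊`. -/
noncomputable def resid (S : Matrix (Fin d) (Fin d) ℝ) (x : Fin d → ℝ) : Fin V.unobs → ℝ :=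
  V.Pminus *ᵥ x - (V.blockMinusPlus S * (V.blockPlus S)⁻¹) *ᵥ (V.Pplus *ᵥ x)

/-- Entry `(a, b)` of `x₊ θ₋ᵀ z zᵀ θ₋ x₊ᵀ`. -/
noncomputable def misfit (S : Matrix (Fin d) (Fin d) ℝ) (θ : Fin d → ℝ)
    (a b : Fin V.obs) (x : Fin d → ℝ) : ℝ :=
  (V.Pplus *ᵥ x) a * ((V.Pminus *ᵥ θ) ⬝ᵥ V.resid S x) ^ 2 * (V.Pplus *ᵥ x) b

/-- `W⋆ = Σ₊ (E[x₊ θ₋ᵀ z zᵀ θ₋ x₊ᵀ] + σ² Σ₊)⁻¹ Σ₊`, the expectation being over `x ∼ μ`. -/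
noncomputable def Wstar (μ : Measure (Fin d → ℝ)) (S : Matrix (Fin d) (Fin d) ℝ)
    (θ : Fin d → ℝ) (σ : ℝ) : Matrix (Fin V.obs) (Fin V.obs) ℝ :=
  V.blockPlus S *
    ((Matrix.of fun a b => ∫ x, V.misfit S θ a b x ∂μ) + σ ^ 2 • V.blockPlus S)⁻¹ *
    V.blockPlus S

/-! ### Local estimators

`X : Matrix (Fin n) (Fin d) ℝ` is the full data matrix of the agent (rows are samples);
the estimators use only its observed part `X₊`. -/

/-- `X₊ = X Π₊ᵀ` -/
def dataPlus {n : ℕ} (X : Matrix (Fin n) (Fin d) ℝ) : Matrix (Fin n) (Fin V.obs) ℝ :=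
  X * V.Pplusᵀ

/-- Local ordinary least squares `X₊† y`. -/
noncomputable def ols {n : ℕ} (X : Matrix (Fin n) (Fin d) ℝ) (y : Fin n → ℝ) :
    Fin V.obs → ℝ :=
  pinv (V.dataPlus X) *ᵥ y

/-- Local imputation estimator `(Tᵀ X₊ᵀ X₊ T)† Tᵀ X₊ᵀ y`. -/
noncomputable def imp (S : Matrix (Fin d) (Fin d) ℝ) {n : ℕ}
    (X : Matrix (Fin n) (Fin d) ℝ) (y : Fin n → ℝ) : Fin d → ℝ :=
  pinv ((V.T S)ᵀ * (V.dataPlus X)ᵀ * V.dataPlus X * V.T S) *ᵥ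
    (((V.T S)ᵀ * (V.dataPlus X)ᵀ) *ᵥ y)

end View

/-! ### Aggregation -/

section Aggregation

variable {d m : ℕ}

/-- The loss `∑ i, ‖Tᵢᵀ (Tᵢ Tᵢᵀ)⁻¹ Tᵢ θ - βᵢ‖²_{Wᵢ}`, where `‖v‖²_W = ⟨v, W v⟩`. -/
noncomputable def impLoss (V : Fin m → View d) (S : Matrix (Fin d) (Fin d) ℝ)
    (W : Fin m → Matrix (Fin d) (Fin d) ℝ) (β : Fin m → Fin d → ℝ) (θ : Fin d → ℝ) : ℝ :=
  ∑ i, (((V i).Tlift S * (V i).T S) *ᵥ θ - β i) ⬝ᵥ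
    (W i *ᵥ (((V i).Tlift S * (V i).T S) *ᵥ θ - β i))

/-- A global minimizer of `f` (arbitrary if there is none). -/
noncomputable def argmin (f : (Fin d → ℝ) → ℝ) : Fin d → ℝ :=
  Classical.epsilon fun θ => ∀ θ', f θ ≤ f θ'

/-- Weights for which the aggregation makes sense: positive semidefinite matrices for which the
quadratic part of the (convex) loss `impLoss` is positive definite, i.e. for which the minimizer
is unique. -/
def Admissible (V : Fin m → View d) (S : Matrix (Fin d) (Fin d) ℝ)
    (W : Fin m → Matrix (Fin d) (Fin d) ℝ) : Prop :=
  (∀ i, (W i).PosSemidef) ∧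
    (∑ i, ((V i).Tlift S * (V i).T S)ᵀ * W i * ((V i).Tlift S * (V i).T S)).PosDef

/-- `C⋆ = (∑ i, Tᵢᵀ Wᵢ⋆ Tᵢ)⁻¹` -/
noncomputable def Cstar (V : Fin m → View d) (μ : Measure (Fin d → ℝ))
    (S : Matrix (Fin d) (Fin d) ℝ) (θ : Fin d → ℝ) (σ : ℝ) : Matrix (Fin d) (Fin d) ℝ :=
  (∑ i, ((V i).T S)ᵀ * (V i).Wstar μ S θ σ * (V i).T S)⁻¹

end Aggregation

/-! ### The samples -/

section Samples

variable {Ω : Type*} {d m : ℕ}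

/-- Data matrix of agent `i` built from its first `n` feature vectors. -/
def dataMat (x : Fin m → ℕ → Ω → (Fin d → ℝ)) (i : Fin m) (n : ℕ) (ω : Ω) :
    Matrix (Fin n) (Fin d) ℝ :=
  Matrix.of fun k => x i k ω

/-- Labels `yᵢ = Xᵢ θ + ξᵢ` of the first `n` samples of agent `i`. -/
def labels (x : Fin m → ℕ → Ω → (Fin d → ℝ)) (ξ : Fin m → ℕ → Ω → ℝ) (θ : Fin d → ℝ)
    (i : Fin m) (n : ℕ) (ω : Ω) : Fin n → ℝ :=
  dataMat x i n ω *ᵥ θ + fun k : Fin n => ξ i k ω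

/-- Local OLS estimator of agent `i` from its first `n` samples. -/
noncomputable def olsEst (V : Fin m → View d) (x : Fin m → ℕ → Ω → (Fin d → ℝ))
    (ξ : Fin m → ℕ → Ω → ℝ) (θ : Fin d → ℝ) (i : Fin m) (n : ℕ) (ω : Ω) :
    Fin (V i).obs → ℝ :=
  (V i).ols (dataMat x i n ω) (labels x ξ θ i n ω)

/-- Local imputation estimator of agent `i` from its first `n` samples. -/
noncomputable def impEst (V : Fin m → View d) (S : Matrix (Fin d) (Fin d) ℝ)
    (x : Fin m → ℕ → Ω → (Fin d → ℝ)) (ξ : Fin m → ℕ → Ω → ℝ) (θ : Fin d → ℝ)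
    (i : Fin m) (n : ℕ) (ω : Ω) : Fin d → ℝ :=
  (V i).imp S (dataMat x i n ω) (labels x ξ θ i n ω)

/-- Aggregated imputation estimator with weights `W` from `n` samples per agent. -/
noncomputable def aggEst (V : Fin m → View d) (S : Matrix (Fin d) (Fin d) ℝ)
    (W : Fin m → Matrix (Fin d) (Fin d) ℝ)
    (x : Fin m → ℕ → Ω → (Fin d → ℝ)) (ξ : Fin m → ℕ → Ω → ℝ) (θ : Fin d → ℝ)
    (n : ℕ) (ω : Ω) : Fin d → ℝ :=
  argmin (impLoss V S W fun i => impEst V S x ξ θ i n ω)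

end Samples

end CollabLS

/-!
When `X₊` has full column rank, the reverse-order law gives `(X₊ T)† = T† X₊†` with
`T† = Tᵀ (T Tᵀ)⁻¹`, so each local imputation estimator is `T†` applied to the local OLS estimator.

The residual `y - X₊ T θ` of a sample is `θ₋ᵀ z + ξ`, where `z` is the error of the population
regression of `x₋` on `x₊`, hence is uncorrelated with `x₊`. So the error of local OLS against `T θ`
is the inverse empirical Gram matrix applied to the mean of the centred i.i.d. scores
`x₊ (θ₋ᵀ z + ξ)`, whose covariance is `Σ₊ (W⋆)⁻¹ Σ₊`. The aggregate is a weighted least squares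
solution, which is linear in the local estimators, and it reproduces `θ` when each local estimator
is `T† T θ`. Its error is therefore a convergent random matrix times a mean of i.i.d. centred
vectors: the law of large numbers gives consistency, and the central limit theorem with Slutsky's
lemma gives asymptotic normality.

In the limit the aggregate is a linear unbiased combination of uncorrelated observations of `Tᵢ θ`
with covariances `(Wᵢ⋆)⁻¹`, and the lower bound `C⋆` is the Gauss–Markov theorem.
-/

namespace CollabLS

/-! ### Moore–Penrose inverses of Gram matrices and products -/

section MoorePenrose

variable {k l o : Type*} [Fintype k] [Fintype l]
  {A : Matrix k l ℝ} {A' : Matrix l k ℝ}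

theorem IsMoorePenrose.pinv_eq [DecidableEq l] (h : IsMoorePenrose A A') : pinv A = A' :=
  (pinv_spec A).unique h

theorem IsMoorePenrose.smul (h : IsMoorePenrose A A') (c : ℝ) :
    IsMoorePenrose (c • A) (c⁻¹ • A') where
  mul_mul_self := by
    simp only [Matrix.smul_mul, Matrix.mul_smul, smul_smul, h.mul_mul_self, mul_comm c,
      inv_mul_mul_self]
  mul_mul_inv := by
    have hc : c⁻¹ * (c * c⁻¹) = c⁻¹ := by
      simpa only [inv_inv, mul_assoc] using mul_inv_mul_cancel c⁻¹
    simp only [Matrix.smul_mul, Matrix.mul_smul, smul_smul, h.mul_mul_inv, hc]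
  symm_left := by
    simp only [Matrix.smul_mul, Matrix.mul_smul, transpose_smul, h.symm_left]
  symm_right := by
    simp only [Matrix.smul_mul, Matrix.mul_smul, transpose_smul, h.symm_right]

theorem IsMoorePenrose.mul_transpose_mul_transpose (h : IsMoorePenrose A A') :
    A' * A'ᵀ * Aᵀ = A' := by
  rw [Matrix.mul_assoc, ← transpose_mul, h.symm_left, ← Matrix.mul_assoc, h.mul_mul_inv]

theorem IsMoorePenrose.transpose_mul_self_mul (h : IsMoorePenrose A A') : Aᵀ * A * A' = Aᵀ := by
  rw [Matrix.mul_assoc, ← h.symm_left, ← transpose_mul, h.mul_mul_self]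

theorem IsMoorePenrose.transpose_mul_self (h : IsMoorePenrose A A') :
    IsMoorePenrose (Aᵀ * A) (A' * A'ᵀ) := by
  have hright : A' * A'ᵀ * (Aᵀ * A) = A' * A := by
    rw [← Matrix.mul_assoc, h.mul_transpose_mul_transpose]
  have hleft : Aᵀ * A * (A' * A'ᵀ) = A' * A := by
    rw [← Matrix.mul_assoc, h.transpose_mul_self_mul, ← transpose_mul, h.symm_right]
  refine ⟨?_, ?_, ?_, ?_⟩
  · rw [Matrix.mul_assoc, hright, ← Matrix.mul_assoc, h.transpose_mul_self_mul]
  · rw [hright, ← Matrix.mul_assoc, h.mul_mul_inv]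
  · rw [hleft, h.symm_right]
  · rw [hright, h.symm_right]

theorem pinv_smul [DecidableEq l] (c : ℝ) (A : Matrix k l ℝ) : pinv (c • A) = c⁻¹ • pinv A :=
  ((pinv_spec A).smul c).pinv_eq

theorem pinv_transpose_mul_self_mul_transpose [DecidableEq l] (A : Matrix k l ℝ) :
    pinv (Aᵀ * A) * Aᵀ = pinv A := by
  rw [(pinv_spec A).transpose_mul_self.pinv_eq, (pinv_spec A).mul_transpose_mul_transpose]

theorem isMoorePenrose_nonsing_inv [DecidableEq l] {G : Matrix l l ℝ} (h : IsUnit G.det) :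
    IsMoorePenrose G G⁻¹ := by
  constructor <;> simp [mul_nonsing_inv _ h, nonsing_inv_mul _ h]

theorem pinv_mul_self [DecidableEq l] (h : IsUnit (Aᵀ * A).det) : pinv A * A = 1 := by
  rw [← pinv_transpose_mul_self_mul_transpose, (isMoorePenrose_nonsing_inv h).pinv_eq,
    Matrix.mul_assoc, nonsing_inv_mul _ h]

theorem isMoorePenrose_transpose_mul_inv [DecidableEq k] (h : IsUnit (A * Aᵀ).det) :
    IsMoorePenrose A (Aᵀ * (A * Aᵀ)⁻¹) where
  mul_mul_self := by rw [← Matrix.mul_assoc A, mul_nonsing_inv _ h, Matrix.one_mul]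
  mul_mul_inv := by
    rw [Matrix.mul_assoc _ A, ← Matrix.mul_assoc A, mul_nonsing_inv _ h, Matrix.mul_one]
  symm_left := by rw [← Matrix.mul_assoc, mul_nonsing_inv _ h, transpose_one]
  symm_right := by simp [transpose_mul, transpose_nonsing_inv, Matrix.mul_assoc]

/-- The reverse-order law, which fails for general `A` and `B`. -/
theorem IsMoorePenrose.mul [Fintype o] [DecidableEq l] {B : Matrix l o ℝ} {B' : Matrix o l ℝ}
    (hA : IsMoorePenrose A A') (hB : IsMoorePenrose B B') (hA' : A' * A = 1) (hB' : B * B' = 1) :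
    IsMoorePenrose (A * B) (B' * A') := by
  have hleft : A * B * (B' * A') = A * A' := by
    rw [Matrix.mul_assoc, ← Matrix.mul_assoc B, hB', Matrix.one_mul]
  have hright : B' * A' * (A * B) = B' * B := by
    rw [Matrix.mul_assoc, ← Matrix.mul_assoc A', hA', Matrix.one_mul]
  refine ⟨?_, ?_, ?_, ?_⟩
  · rw [hleft, ← Matrix.mul_assoc, hA.mul_mul_self]
  · rw [hright, ← Matrix.mul_assoc, hB.mul_mul_inv]
  · rw [hleft, hA.symm_left]
  · rw [hright, hB.symm_right]

theorem rank_eq_card_iff_isUnit_det_transpose_mul_self [DecidableEq l] (A : Matrix k l ℝ) :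
    A.rank = Fintype.card l ↔ IsUnit (Aᵀ * A).det := by
  rw [← rank_transpose_mul_self, ← isUnit_iff_isUnit_det]
  refine ⟨fun h => ?_, fun h => rank_of_isUnit _ h⟩
  rw [← mulVec_surjective_iff_isUnit, ← coe_mulVecLin, ← LinearMap.range_eq_top]
  exact Submodule.eq_top_of_finrank_eq (by rw [Module.finrank_pi]; exact h)

theorem continuousAt_pinv [DecidableEq l] {G : Matrix l l ℝ} (h : IsUnit G.det) :
    ContinuousAt pinv G := by
  have hinverse : ContinuousAt Ring.inverse G.det := by
    rw [Ring.inverse_eq_inv']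
    exact continuousAt_inv₀ h.ne_zero
  refine (continuousAt_matrix_inv G hinverse).congr ?_
  filter_upwards [continuous_id.matrix_det.continuousAt.eventually_ne h.ne_zero] with H hH
  exact (isMoorePenrose_nonsing_inv (isUnit_iff_ne_zero.2 hH)).pinv_eq.symm

end MoorePenrose

/-! ### Measurability of the Moore–Penrose inverse -/

section Measurability

theorem measurable_of_isClosed_graph {X Y : Type*} [TopologicalSpace X] [MeasurableSpace X]
    [BorelSpace X] [T2Space X] [SigmaCompactSpace X] [TopologicalSpace Y] [MeasurableSpace Y]
    [BorelSpace Y] [SigmaCompactSpace Y] {f : X → Y}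
    (hf : IsClosed {p : X × Y | p.2 = f p.1}) : Measurable f := by
  refine measurable_of_isClosed fun C hC => ?_
  have h : f ⁻¹' C = Prod.fst '' ({p : X × Y | p.2 = f p.1} ∩ Prod.snd ⁻¹' C) := by
    ext x
    simp
  obtain ⟨K, hK, hKU⟩ : IsSigmaCompact (f ⁻¹' C) := by
    rw [h]
    exact (isSigmaCompact_univ.of_isClosed_subset (hf.inter (hC.preimage continuous_snd))
      (Set.subset_univ _)).image continuous_fst
  rw [← hKU]
  exact MeasurableSet.iUnion fun n => (hK n).isClosed.measurableSet

theorem isClosed_setOf_isMoorePenrose {k l : Type*} [Fintype k] [Fintype l] :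
    IsClosed {p : Matrix k l ℝ × Matrix l k ℝ | IsMoorePenrose p.1 p.2} := by
  have h : {p : Matrix k l ℝ × Matrix l k ℝ | IsMoorePenrose p.1 p.2} =
      {p | p.1 * p.2 * p.1 = p.1} ∩ {p | p.2 * p.1 * p.2 = p.2} ∩
      {p | (p.1 * p.2)ᵀ = p.1 * p.2} ∩ {p | (p.2 * p.1)ᵀ = p.2 * p.1} :=
    Set.ext fun p => ⟨fun ⟨h1, h2, h3, h4⟩ => ⟨⟨⟨h1, h2⟩, h3⟩, h4⟩,
      fun ⟨⟨⟨h1, h2⟩, h3⟩, h4⟩ => ⟨h1, h2, h3, h4⟩⟩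
  rw [h]
  refine ((IsClosed.inter ?_ ?_).inter ?_).inter ?_ <;>
    exact isClosed_eq (by fun_prop) (by fun_prop)

theorem measurable_pinv {k l : Type*} [Fintype k] [Fintype l] [DecidableEq l] :
    Measurable fun (A : k → l → ℝ) (i : l) (j : k) => pinv (of A) i j := by
  refine measurable_of_isClosed_graph ?_
  have h : {p : (k → l → ℝ) × (l → k → ℝ) | p.2 = fun i j => pinv (of p.1) i j} =
      {p | IsMoorePenrose (of p.1) (of p.2)} := by
    ext ⟨A, B⟩
    refine ⟨?_, fun hp => hp.pinv_eq.symm⟩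
    rintro (rfl : B = fun i j => pinv (of A) i j)
    exact pinv_spec (of A)
  rw [h]
  exact isClosed_setOf_isMoorePenrose

variable {Ω k l : Type*} [MeasurableSpace Ω] {P : Measure Ω} [Fintype l]
  {A : Ω → Matrix k l ℝ}

theorem aemeasurable_pinv [Fintype k] [DecidableEq l]
    (hA : ∀ a b, AEMeasurable (fun ω => A ω a b) P) (b : l) (a : k) :
    AEMeasurable (fun ω => pinv (A ω) b a) P := by
  have hA' : AEMeasurable (fun ω a b => A ω a b) P :=
    aemeasurable_pi_lambda _ fun a => aemeasurable_pi_lambda _ fun b => hA a b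
  exact aemeasurable_pi_iff.1 (aemeasurable_pi_iff.1 (measurable_pinv.comp_aemeasurable hA') b) a

theorem aemeasurable_matrix_mul {o : Type*} {B : Ω → Matrix l o ℝ}
    (hA : ∀ a b, AEMeasurable (fun ω => A ω a b) P)
    (hB : ∀ b c, AEMeasurable (fun ω => B ω b c) P) (a : k) (c : o) :
    AEMeasurable (fun ω => (A ω * B ω) a c) P := by
  simp only [Matrix.mul_apply]
  exact Finset.aemeasurable_fun_sum _ fun b _ => (hA a b).mul (hB b c)

theorem aemeasurable_mulVec {v : Ω → l → ℝ} (hA : ∀ a b, AEMeasurable (fun ω => A ω a b) P)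
    (hv : ∀ b, AEMeasurable (fun ω => v ω b) P) (a : k) :
    AEMeasurable (fun ω => (A ω *ᵥ v ω) a) P := by
  simp only [mulVec, dotProduct]
  exact Finset.aemeasurable_fun_sum _ fun b _ => (hA a b).mul (hv b)

end Measurability

/-! ### Weighted least squares -/

section WeightedLeastSquares

variable {κ k : Type*} {l : κ → Type*} [Fintype κ] [∀ i, Fintype (l i)]
  {A : (i : κ) → Matrix (l i) k ℝ} {U : (i : κ) → Matrix (l i) (l i) ℝ}
  {L : (i : κ) → Matrix k (l i) ℝ} {β : (i : κ) → l i → ℝ}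

/-- The normal matrix `∑ i, Aᵢᵀ Uᵢ Aᵢ` of the problem of minimizing `∑ i, ‖Aᵢ t - βᵢ‖²_{Uᵢ}`. -/
def normalMatrix (A : (i : κ) → Matrix (l i) k ℝ) (U : (i : κ) → Matrix (l i) (l i) ℝ) :
    Matrix k k ℝ :=
  ∑ i, (A i)ᵀ * U i * A i

/-- The weighted least-squares loss `∑ i, ‖Aᵢ t - βᵢ‖²_{Uᵢ}`. -/
def wlsLoss [Fintype k] (A : (i : κ) → Matrix (l i) k ℝ) (U : (i : κ) → Matrix (l i) (l i) ℝ)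
    (β : (i : κ) → l i → ℝ) (t : k → ℝ) : ℝ :=
  ∑ i, (A i *ᵥ t - β i) ⬝ᵥ (U i *ᵥ (A i *ᵥ t - β i))

/-- The matrices `(∑ j, Aⱼᵀ Uⱼ Aⱼ)⁻¹ Aᵢᵀ Uᵢ` through which the weighted least-squares solution
depends on the data. -/
noncomputable def wlsGain [Fintype k] [DecidableEq k] (A : (i : κ) → Matrix (l i) k ℝ)
    (U : (i : κ) → Matrix (l i) (l i) ℝ) (i : κ) : Matrix k (l i) ℝ :=
  (normalMatrix A U)⁻¹ * (A i)ᵀ * U i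

/-- The weighted least-squares solution, i.e. the minimizer of `wlsLoss A U β`. -/
noncomputable def wlsSol [Fintype k] [DecidableEq k] (A : (i : κ) → Matrix (l i) k ℝ)
    (U : (i : κ) → Matrix (l i) (l i) ℝ) (β : (i : κ) → l i → ℝ) : k → ℝ :=
  ∑ i, wlsGain A U i *ᵥ β i

/-- The covariance `∑ i, Lᵢ Kᵢ Lᵢᵀ` of `∑ i, Lᵢ eᵢ` for uncorrelated errors `eᵢ` with
covariances `Kᵢ`. -/
def combinedCov (L : (i : κ) → Matrix k (l i) ℝ) (K : (i : κ) → Matrix (l i) (l i) ℝ) :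
    Matrix k k ℝ :=
  ∑ i, L i * K i * (L i)ᵀ

theorem posSemidef_combinedCov [Finite k] {K : (i : κ) → Matrix (l i) (l i) ℝ}
    (hK : ∀ i, (K i).PosSemidef) : (combinedCov L K).PosSemidef :=
  posSemidef_sum _ fun i _ => by simpa using (hK i).mul_mul_conjTranspose_same (L i)

variable [Fintype k]

theorem dotProduct_normalMatrix_mulVec (v w : k → ℝ) :
    v ⬝ᵥ (normalMatrix A U *ᵥ w) = ∑ i, (A i *ᵥ v) ⬝ᵥ (U i *ᵥ (A i *ᵥ w)) := by
  simp only [normalMatrix, sum_mulVec, dotProduct_sum, ← mulVec_mulVec, dotProduct_mulVec,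
    vecMul_transpose]

theorem posDef_normalMatrix (hU : ∀ i, (U i).PosDef)
    (hA : ∀ v, (∀ i, A i *ᵥ v = 0) → v = 0) : (normalMatrix A U).PosDef := by
  have hterm : ∀ i, ((A i)ᵀ * U i * A i).PosSemidef := fun i => by
    simpa using (hU i).posSemidef.conjTranspose_mul_mul_same (A i)
  refine .of_dotProduct_mulVec_pos (posSemidef_sum _ fun i _ => hterm i).isHermitian fun v hv => ?_
  obtain ⟨i, hi⟩ : ∃ i, A i *ᵥ v ≠ 0 := by
    by_contra! h
    exact hv (hA v h)
  rw [star_trivial, dotProduct_normalMatrix_mulVec]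
  refine Finset.sum_pos' (fun j _ => ?_) ⟨i, Finset.mem_univ i, ?_⟩
  · simpa using (hU j).posSemidef.dotProduct_mulVec_nonneg (A j *ᵥ v)
  · simpa using (hU i).dotProduct_mulVec_pos hi

theorem wlsLoss_add (hU : ∀ i, (U i).IsSymm) (t v : k → ℝ) :
    wlsLoss A U β (t + v) = wlsLoss A U β t +
      2 * (v ⬝ᵥ (normalMatrix A U *ᵥ t - ∑ i, (A i)ᵀ *ᵥ (U i *ᵥ β i))) +
      v ⬝ᵥ (normalMatrix A U *ᵥ v) := by
  have hsymm : ∀ i (r w : l i → ℝ), r ⬝ᵥ (U i *ᵥ w) = w ⬝ᵥ (U i *ᵥ r) := fun i r w => by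
    rw [dotProduct_mulVec, ← mulVec_transpose, hU i, dotProduct_comm]
  have hdata : v ⬝ᵥ (∑ i, (A i)ᵀ *ᵥ (U i *ᵥ β i)) = ∑ i, (A i *ᵥ v) ⬝ᵥ (U i *ᵥ β i) := by
    simp only [dotProduct_sum, dotProduct_mulVec, vecMul_transpose]
  simp only [dotProduct_sub, dotProduct_normalMatrix_mulVec, hdata, wlsLoss]
  rw [← Finset.sum_sub_distrib, Finset.mul_sum, ← Finset.sum_add_distrib,
    ← Finset.sum_add_distrib]
  refine Finset.sum_congr rfl fun i _ => ?_
  rw [mulVec_add, add_sub_right_comm, mulVec_add, add_dotProduct, dotProduct_add, dotProduct_add,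
    hsymm i (A i *ᵥ t - β i) (A i *ᵥ v), ← dotProduct_sub, ← mulVec_sub]
  ring

variable [DecidableEq k]

theorem sum_wlsGain_mul (hM : (normalMatrix A U).PosDef) : ∑ i, wlsGain A U i * A i = 1 := by
  simp only [wlsGain, Matrix.mul_assoc]
  rw [← Finset.mul_sum]
  simp only [← Matrix.mul_assoc]
  exact nonsing_inv_mul _ ((isUnit_iff_isUnit_det _).1 hM.isUnit)

theorem normalMatrix_mulVec_wlsSol (hM : (normalMatrix A U).PosDef) :
    normalMatrix A U *ᵥ wlsSol A U β = ∑ i, (A i)ᵀ *ᵥ (U i *ᵥ β i) := by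
  have hdet := (isUnit_iff_isUnit_det _).1 hM.isUnit
  simp only [wlsSol, wlsGain, mulVec_sum, mulVec_mulVec, ← Matrix.mul_assoc,
    mul_nonsing_inv _ hdet, Matrix.one_mul]

theorem wlsLoss_eq_add (hU : ∀ i, (U i).IsSymm) (hM : (normalMatrix A U).PosDef) (t : k → ℝ) :
    wlsLoss A U β t = wlsLoss A U β (wlsSol A U β) +
      (t - wlsSol A U β) ⬝ᵥ (normalMatrix A U *ᵥ (t - wlsSol A U β)) := by
  have h := wlsLoss_add (A := A) (β := β) hU (wlsSol A U β) (t - wlsSol A U β)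
  rwa [add_sub_cancel, normalMatrix_mulVec_wlsSol hM, sub_self, dotProduct_zero, mul_zero,
    add_zero] at h

theorem forall_wlsLoss_le_iff (hU : ∀ i, (U i).IsSymm) (hM : (normalMatrix A U).PosDef)
    {t : k → ℝ} : (∀ t', wlsLoss A U β t ≤ wlsLoss A U β t') ↔ t = wlsSol A U β := by
  constructor
  · intro ht
    by_contra hne
    have hpos := hM.dotProduct_mulVec_pos (sub_ne_zero.2 hne)
    have hle := ht (wlsSol A U β)
    rw [wlsLoss_eq_add hU hM t] at hle
    rw [star_trivial] at hpos
    linarith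
  · rintro rfl t'
    have hnonneg := hM.posSemidef.dotProduct_mulVec_nonneg (t' - wlsSol A U β)
    rw [wlsLoss_eq_add hU hM t']
    rw [star_trivial] at hnonneg
    linarith

theorem wlsSol_sub (hM : (normalMatrix A U).PosDef) (t : k → ℝ) :
    wlsSol A U β - t = wlsSol A U fun i => β i - A i *ᵥ t := by
  simp only [wlsSol, mulVec_sub, Finset.sum_sub_distrib, mulVec_mulVec, ← sum_mulVec,
    sum_wlsGain_mul hM, one_mulVec]

variable [∀ i, DecidableEq (l i)]

theorem inv_mul_wlsGain_transpose (hU : ∀ i, (U i).PosDef) (i : κ) :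
    (U i)⁻¹ * (wlsGain A U i)ᵀ = A i * (normalMatrix A U)⁻¹ := by
  have hsymm : ∀ j, (U j)ᵀ = U j := fun j =>
    isHermitian_iff_isSymm.1 (hU j).isHermitian
  have hMsymm : (normalMatrix A U)ᵀ = normalMatrix A U := by
    simp only [normalMatrix, transpose_sum, transpose_mul, transpose_transpose, hsymm,
      Matrix.mul_assoc]
  rw [wlsGain, transpose_mul, transpose_mul, transpose_transpose, hsymm, transpose_nonsing_inv,
    hMsymm, ← Matrix.mul_assoc, nonsing_inv_mul _ ((isUnit_iff_isUnit_det _).1 (hU i).isUnit),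
    Matrix.one_mul]

theorem sum_mul_inv_mul_wlsGain_transpose (hU : ∀ i, (U i).PosDef) (hL : ∑ i, L i * A i = 1) :
    ∑ i, L i * (U i)⁻¹ * (wlsGain A U i)ᵀ = (normalMatrix A U)⁻¹ := by
  simp only [Matrix.mul_assoc, inv_mul_wlsGain_transpose hU]
  simp only [← Matrix.mul_assoc, ← Finset.sum_mul, hL, Matrix.one_mul]

theorem combinedCov_wlsGain (hU : ∀ i, (U i).PosDef) (hM : (normalMatrix A U).PosDef) :
    combinedCov (wlsGain A U) (fun i => (U i)⁻¹) = (normalMatrix A U)⁻¹ :=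
  sum_mul_inv_mul_wlsGain_transpose hU (sum_wlsGain_mul hM)

/-- The Gauss–Markov theorem, as an exact identity. -/
theorem combinedCov_sub_inv_normalMatrix (hU : ∀ i, (U i).PosDef)
    (hM : (normalMatrix A U).PosDef) (hL : ∑ i, L i * A i = 1) :
    combinedCov L (fun i => (U i)⁻¹) - (normalMatrix A U)⁻¹ =
      combinedCov (fun i => L i - wlsGain A U i) fun i => (U i)⁻¹ := by
  have hcross := sum_mul_inv_mul_wlsGain_transpose hU hL
  have hcross' : ∑ i, wlsGain A U i * (U i)⁻¹ * (L i)ᵀ = (normalMatrix A U)⁻¹ := by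
    have hsymm : ∀ i, ((U i)⁻¹)ᵀ = (U i)⁻¹ := fun i =>
      isHermitian_iff_isSymm.1 (hU i).inv.isHermitian
    have hMsymm : ((normalMatrix A U)⁻¹)ᵀ = (normalMatrix A U)⁻¹ :=
      isHermitian_iff_isSymm.1 hM.inv.isHermitian
    simpa only [transpose_sum, transpose_mul, transpose_transpose, hsymm, hMsymm,
      ← Matrix.mul_assoc] using congrArg transpose hcross
  have hgain := combinedCov_wlsGain hU hM
  simp only [combinedCov, transpose_sub, Matrix.mul_sub, Matrix.sub_mul,
    Finset.sum_sub_distrib] at hgain ⊢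
  rw [hcross, hcross', hgain]
  abel

theorem posSemidef_combinedCov_sub_inv_normalMatrix (hU : ∀ i, (U i).PosDef)
    (hM : (normalMatrix A U).PosDef) (hL : ∑ i, L i * A i = 1) :
    (combinedCov L (fun i => (U i)⁻¹) - (normalMatrix A U)⁻¹).PosSemidef := by
  rw [combinedCov_sub_inv_normalMatrix hU hM hL]
  exact posSemidef_combinedCov fun i => (hU i).inv.posSemidef

end WeightedLeastSquares

/-! ### Imputation -/

namespace View

variable {d : ℕ} (V : View d) {S : Matrix (Fin d) (Fin d) ℝ}

theorem Pplus_mulVec_apply (v : Fin d → ℝ) (a : Fin V.obs) :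
    (V.Pplus *ᵥ v) a = v (V.perm (Sum.inl a)) := by
  simp [Pplus, mulVec, dotProduct]

theorem Pplus_mul_transpose : V.Pplus * V.Pplusᵀ = 1 := by
  ext a b
  simp [Pplus, Matrix.mul_apply, Matrix.one_apply, eq_comm]

theorem Pminus_mul_Pplus_transpose : V.Pminus * V.Pplusᵀ = 0 := by
  ext a b
  simp [Pplus, Pminus, Matrix.mul_apply]

theorem transpose_mul_Pplus_add_transpose_mul_Pminus :
    V.Pplusᵀ * V.Pplus + V.Pminusᵀ * V.Pminus = 1 := by
  ext i j
  obtain ⟨i, rfl⟩ := V.perm.surjective i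
  obtain ⟨j, rfl⟩ := V.perm.surjective j
  rcases i with i | i <;> rcases j with j | j <;>
    simp [Pplus, Pminus, Matrix.mul_apply, Matrix.one_apply, eq_comm]

theorem posDef_blockPlus (hS : S.PosDef) : (V.blockPlus S).PosDef := by
  have hinj : Function.Injective fun v => v ᵥ* V.Pplus := fun v w h => by
    simpa [vecMul_vecMul, Pplus_mul_transpose] using congrArg (· ᵥ* V.Pplusᵀ) h
  simpa [blockPlus] using hS.mul_mul_conjTranspose_same hinj

theorem isUnit_det_blockPlus (hS : S.PosDef) : IsUnit (V.blockPlus S).det :=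
  (isUnit_iff_isUnit_det _).1 (V.posDef_blockPlus hS).isUnit

theorem T_eq_Pplus_add :
    V.T S = V.Pplus + (V.blockPlus S)⁻¹ * V.blockPlusMinus S * V.Pminus := by
  rw [T, P, fromCols_mul_fromRows, Matrix.one_mul]

theorem T_mul_Pplus_transpose : V.T S * V.Pplusᵀ = 1 := by
  rw [T_eq_Pplus_add, Matrix.add_mul, Pplus_mul_transpose, Matrix.mul_assoc,
    Pminus_mul_Pplus_transpose, Matrix.mul_zero, add_zero]

theorem blockPlus_mul_T (hS : S.PosDef) : V.blockPlus S * V.T S = V.Pplus * S := by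
  calc V.blockPlus S * V.T S
      = V.blockPlus S * V.Pplus + V.blockPlusMinus S * V.Pminus := by
        rw [T_eq_Pplus_add, Matrix.mul_add, ← Matrix.mul_assoc, ← Matrix.mul_assoc,
          mul_nonsing_inv _ (V.isUnit_det_blockPlus hS), Matrix.one_mul]
    _ = V.Pplus * S * (V.Pplusᵀ * V.Pplus + V.Pminusᵀ * V.Pminus) := by
        simp only [blockPlus, blockPlusMinus, Matrix.mul_add, Matrix.mul_assoc]
    _ = V.Pplus * S := by rw [transpose_mul_Pplus_add_transpose_mul_Pminus, Matrix.mul_one]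

theorem isUnit_det_T_mul_transpose : IsUnit (V.T S * (V.T S)ᵀ).det := by
  have hinj : Function.Injective fun v => v ᵥ* V.T S := fun v w h => by
    simpa [vecMul_vecMul, T_mul_Pplus_transpose] using congrArg (· ᵥ* V.Pplusᵀ) h
  have hpos : (V.T S * (V.T S)ᵀ).PosDef := by
    simpa using PosDef.mul_conjTranspose_self (V.T S) hinj
  exact (isUnit_iff_isUnit_det _).1 hpos.isUnit

theorem isMoorePenrose_Tlift : IsMoorePenrose (V.T S) (V.Tlift S) :=
  isMoorePenrose_transpose_mul_inv V.isUnit_det_T_mul_transpose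

theorem T_mul_Tlift : V.T S * V.Tlift S = 1 := by
  rw [Tlift, ← Matrix.mul_assoc, mul_nonsing_inv _ V.isUnit_det_T_mul_transpose]

theorem imp_eq_pinv_mulVec {n : ℕ} (X : Matrix (Fin n) (Fin d) ℝ) (y : Fin n → ℝ) :
    V.imp S X y = pinv (V.dataPlus X * V.T S) *ᵥ y := by
  rw [imp, mulVec_mulVec, ← transpose_mul, Matrix.mul_assoc _ (V.dataPlus X),
    pinv_transpose_mul_self_mul_transpose]

theorem imp_eq_Tlift_mulVec_ols {n : ℕ} {X : Matrix (Fin n) (Fin d) ℝ} (y : Fin n → ℝ)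
    (hX : IsUnit ((V.dataPlus X)ᵀ * V.dataPlus X).det) :
    V.imp S X y = V.Tlift S *ᵥ V.ols X y := by
  have hpinv := (pinv_spec (V.dataPlus X)).mul (V.isMoorePenrose_Tlift (S := S))
    (pinv_mul_self hX) V.T_mul_Tlift
  rw [imp_eq_pinv_mulVec, hpinv.pinv_eq, ols, mulVec_mulVec]

theorem ols_sub {n : ℕ} {X : Matrix (Fin n) (Fin d) ℝ} (y : Fin n → ℝ) (b : Fin V.obs → ℝ)
    (hX : IsUnit ((V.dataPlus X)ᵀ * V.dataPlus X).det) :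
    V.ols X y - b = pinv ((V.dataPlus X)ᵀ * V.dataPlus X) *ᵥ
      ((V.dataPlus X)ᵀ *ᵥ (y - V.dataPlus X *ᵥ b)) := by
  rw [mulVec_mulVec, pinv_transpose_mul_self_mul_transpose, mulVec_sub, mulVec_mulVec,
    pinv_mul_self hX, one_mulVec, ols]

/-- The orthogonal projection `Tᵀ (T Tᵀ)⁻¹ T` onto the row space of `T`. -/
noncomputable def proj (S : Matrix (Fin d) (Fin d) ℝ) : Matrix (Fin d) (Fin d) ℝ :=
  V.Tlift S * V.T S

theorem T_mul_proj : V.T S * V.proj S = V.T S := by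
  rw [proj, ← Matrix.mul_assoc, T_mul_Tlift, Matrix.one_mul]

end View

/-! ### Aggregation -/

section Aggregation

variable {d m : ℕ} {V : Fin m → View d} {S : Matrix (Fin d) (Fin d) ℝ}
  {W : Fin m → Matrix (Fin d) (Fin d) ℝ}
  {U : (i : Fin m) → Matrix (Fin (V i).obs) (Fin (V i).obs) ℝ}

theorem eq_zero_of_forall_T_mulVec_eq_zero
    (hcover : ∀ j : Fin d, ∃ i : Fin m, ∃ a : Fin (V i).obs, (V i).perm (Sum.inl a) = j)
    (hS : S.PosDef) {v : Fin d → ℝ} (hv : ∀ i, (V i).T S *ᵥ v = 0) : v = 0 := by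
  have hobserved : ∀ i, (V i).Pplus *ᵥ (S *ᵥ v) = 0 := fun i => by
    rw [mulVec_mulVec, ← (V i).blockPlus_mul_T hS, ← mulVec_mulVec, hv i, mulVec_zero]
  have hSv : S *ᵥ v = 0 := by
    funext j
    obtain ⟨i, a, rfl⟩ := hcover j
    rw [← (V i).Pplus_mulVec_apply (S *ᵥ v) a, hobserved i, Pi.zero_apply, Pi.zero_apply]
  exact mulVec_injective_iff_isUnit.2 hS.isUnit (by rw [hSv, mulVec_zero])

theorem posDef_normalMatrix_T
    (hcover : ∀ j : Fin d, ∃ i : Fin m, ∃ a : Fin (V i).obs, (V i).perm (Sum.inl a) = j)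
    (hS : S.PosDef) (hU : ∀ i, (U i).PosDef) : (normalMatrix (fun i => (V i).T S) U).PosDef :=
  posDef_normalMatrix hU fun _ => eq_zero_of_forall_T_mulVec_eq_zero hcover hS

theorem normalMatrix_proj :
    normalMatrix (fun i => (V i).proj S) (fun i => ((V i).T S)ᵀ * U i * (V i).T S) =
      normalMatrix (fun i => (V i).T S) U := by
  refine Finset.sum_congr rfl fun i _ => ?_
  calc ((V i).proj S)ᵀ * (((V i).T S)ᵀ * U i * (V i).T S) * (V i).proj S
      = ((V i).T S * (V i).proj S)ᵀ * U i * ((V i).T S * (V i).proj S) := by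
        simp only [transpose_mul, Matrix.mul_assoc]
    _ = ((V i).T S)ᵀ * U i * (V i).T S := by rw [View.T_mul_proj]

theorem admissible_of_posDef
    (hcover : ∀ j : Fin d, ∃ i : Fin m, ∃ a : Fin (V i).obs, (V i).perm (Sum.inl a) = j)
    (hS : S.PosDef) (hW : ∀ i, (W i).PosDef) : Admissible V S W := by
  refine ⟨fun i => (hW i).posSemidef, posDef_normalMatrix hW fun v hv => ?_⟩
  refine eq_zero_of_forall_T_mulVec_eq_zero hcover hS fun i => ?_
  rw [← View.T_mul_proj, View.proj, ← mulVec_mulVec, hv i, mulVec_zero]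

theorem admissible_transpose_mul_mul_T
    (hcover : ∀ j : Fin d, ∃ i : Fin m, ∃ a : Fin (V i).obs, (V i).perm (Sum.inl a) = j)
    (hS : S.PosDef) (hU : ∀ i, (U i).PosDef) :
    Admissible V S fun i => ((V i).T S)ᵀ * U i * (V i).T S := by
  refine ⟨fun i => ?_, ?_⟩
  · simpa using (hU i).posSemidef.conjTranspose_mul_mul_same ((V i).T S)
  · have hM := posDef_normalMatrix_T hcover hS hU
    rwa [← normalMatrix_proj] at hM

theorem Admissible.posDef_normalMatrix (hW : Admissible V S W) :
    (normalMatrix (fun i => (V i).proj S) W).PosDef :=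
  hW.2

theorem Admissible.forall_impLoss_le_iff (hW : Admissible V S W) {β : Fin m → Fin d → ℝ}
    {t : Fin d → ℝ} :
    (∀ t', impLoss V S W β t ≤ impLoss V S W β t') ↔
      t = wlsSol (fun i => (V i).proj S) W β :=
  forall_wlsLoss_le_iff (fun i => isHermitian_iff_isSymm.1 (hW.1 i).isHermitian)
    hW.posDef_normalMatrix

theorem Admissible.existsUnique_forall_impLoss_le (hW : Admissible V S W)
    (β : Fin m → Fin d → ℝ) :
    ∃! t, ∀ t', impLoss V S W β t ≤ impLoss V S W β t' :=
  ⟨_, hW.forall_impLoss_le_iff.2 rfl, fun _ ht => hW.forall_impLoss_le_iff.1 ht⟩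

theorem Admissible.argmin_impLoss (hW : Admissible V S W) (β : Fin m → Fin d → ℝ) :
    argmin (impLoss V S W β) = wlsSol (fun i => (V i).proj S) W β :=
  hW.forall_impLoss_le_iff.1
    (Classical.epsilon_spec (hW.existsUnique_forall_impLoss_le β).exists)

/-- The matrices through which the aggregated estimator depends on the local OLS estimators. -/
noncomputable def aggGain (V : Fin m → View d) (S : Matrix (Fin d) (Fin d) ℝ)
    (W : Fin m → Matrix (Fin d) (Fin d) ℝ) (i : Fin m) : Matrix (Fin d) (Fin (V i).obs) ℝ :=
  wlsGain (fun i => (V i).proj S) W i * (V i).Tlift S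

theorem Admissible.sum_aggGain_mul_T (hW : Admissible V S W) :
    ∑ i, aggGain V S W i * (V i).T S = 1 := by
  simpa only [aggGain, Matrix.mul_assoc] using! sum_wlsGain_mul hW.posDef_normalMatrix

theorem aggGain_transpose_mul_mul_T :
    aggGain V S (fun i => ((V i).T S)ᵀ * U i * (V i).T S) = wlsGain (fun i => (V i).T S) U := by
  funext i
  rw [aggGain, wlsGain, wlsGain, normalMatrix_proj]
  calc (normalMatrix (fun i => (V i).T S) U)⁻¹ * ((V i).proj S)ᵀ *
        (((V i).T S)ᵀ * U i * (V i).T S) * (V i).Tlift S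
      = (normalMatrix (fun i => (V i).T S) U)⁻¹ * ((V i).T S * (V i).proj S)ᵀ * U i *
          ((V i).T S * (V i).Tlift S) := by simp only [transpose_mul, Matrix.mul_assoc]
    _ = (normalMatrix (fun i => (V i).T S) U)⁻¹ * ((V i).T S)ᵀ * U i := by
        rw [View.T_mul_proj, View.T_mul_Tlift, Matrix.mul_one]

theorem Admissible.argmin_impLoss_sub (hW : Admissible V S W) (θ : Fin d → ℝ)
    (b : (i : Fin m) → Fin (V i).obs → ℝ) :
    argmin (impLoss V S W fun i => (V i).Tlift S *ᵥ b i) - θ =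
      ∑ i, aggGain V S W i *ᵥ (b i - (V i).T S *ᵥ θ) := by
  rw [hW.argmin_impLoss, wlsSol_sub hW.posDef_normalMatrix, wlsSol]
  refine Finset.sum_congr rfl fun i _ => ?_
  rw [aggGain, ← mulVec_mulVec, mulVec_sub _ (b i), View.proj, mulVec_mulVec]

/-- The asymptotic covariance of the aggregated estimator when `√n` times the error of the `i`-th
local OLS estimator has asymptotic covariance `(Uᵢ)⁻¹`. -/
noncomputable def aggCov (V : Fin m → View d) (S : Matrix (Fin d) (Fin d) ℝ)
    (U : (i : Fin m) → Matrix (Fin (V i).obs) (Fin (V i).obs) ℝ)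
    (W : Fin m → Matrix (Fin d) (Fin d) ℝ) : Matrix (Fin d) (Fin d) ℝ :=
  combinedCov (aggGain V S W) fun i => (U i)⁻¹

theorem posSemidef_aggCov (hU : ∀ i, (U i).PosDef) : (aggCov V S U W).PosSemidef :=
  posSemidef_combinedCov fun i => (hU i).inv.posSemidef

theorem Admissible.posSemidef_aggCov_sub (hW : Admissible V S W) (hU : ∀ i, (U i).PosDef)
    (hM : (normalMatrix (fun i => (V i).T S) U).PosDef) :
    (aggCov V S U W - (normalMatrix (fun i => (V i).T S) U)⁻¹).PosSemidef :=
  posSemidef_combinedCov_sub_inv_normalMatrix hU hM hW.sum_aggGain_mul_T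

theorem aggCov_transpose_mul_mul_T (hU : ∀ i, (U i).PosDef)
    (hM : (normalMatrix (fun i => (V i).T S) U).PosDef) :
    aggCov V S U (fun i => ((V i).T S)ᵀ * U i * (V i).T S) =
      (normalMatrix (fun i => (V i).T S) U)⁻¹ := by
  rw [aggCov, aggGain_transpose_mul_mul_T, combinedCov_wlsGain hU hM]

end Aggregation

/-! ### Second moments -/

section SecondMoments

variable {Ω : Type*} [MeasurableSpace Ω] {Pr : Measure Ω} {ι κ : Type*}

/-- The random vector `Y` is square-integrable with matrix of second moments `K = E[Y Yᵀ]`. -/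
structure HasSecondMoment (Y : Ω → ι → ℝ) (K : Matrix ι ι ℝ) (Pr : Measure Ω) : Prop where
  memLp : ∀ a, MemLp (fun ω => Y ω a) 2 Pr
  integral_mul : ∀ a b, ∫ ω, Y ω a * Y ω b ∂Pr = K a b

namespace HasSecondMoment

variable {Y : Ω → ι → ℝ} {K : Matrix ι ι ℝ}

theorem integrable_mul (hY : HasSecondMoment Y K Pr) (a b : ι) :
    Integrable (fun ω => Y ω a * Y ω b) Pr :=
  (hY.memLp a).integrable_mul (hY.memLp b)

theorem integrable [IsFiniteMeasure Pr] (hY : HasSecondMoment Y K Pr) (a : ι) :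
    Integrable (fun ω => Y ω a) Pr :=
  (hY.memLp a).integrable one_le_two

theorem comp_hasLaw {Ω' : Type*} [MeasurableSpace Ω'] {Pr' : Measure Ω'} {Z : Ω' → Ω}
    (hY : HasSecondMoment Y K Pr) (hZ : HasLaw Z Pr Pr') :
    HasSecondMoment (fun ω => Y (Z ω)) K Pr' where
  memLp a := by
    have h := hY.memLp a
    rw [← hZ.map_eq] at h
    exact h.comp_of_map hZ.aemeasurable
  integral_mul a b :=
    (hZ.integral_comp (hY.integrable_mul a b).aestronglyMeasurable).trans (hY.integral_mul a b)

variable [Fintype ι]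

theorem memLp_dotProduct (hY : HasSecondMoment Y K Pr) (u : ι → ℝ) :
    MemLp (fun ω => u ⬝ᵥ Y ω) 2 Pr :=
  memLp_finsetSum _ fun a _ => (hY.memLp a).const_mul (u a)

theorem integral_dotProduct_mul_dotProduct (hY : HasSecondMoment Y K Pr) (u v : ι → ℝ) :
    ∫ ω, (u ⬝ᵥ Y ω) * (v ⬝ᵥ Y ω) ∂Pr = u ⬝ᵥ (K *ᵥ v) := by
  have hterm : ∀ a b, Integrable (fun ω => u a * Y ω a * (v b * Y ω b)) Pr := fun a b =>
    ((hY.memLp a).const_mul (u a)).integrable_mul ((hY.memLp b).const_mul (v b))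
  simp only [dotProduct, Finset.sum_mul_sum]
  rw [integral_finsetSum _ fun a _ => integrable_finsetSum _ fun b _ => hterm a b]
  refine Finset.sum_congr rfl fun a _ => ?_
  rw [integral_finsetSum _ fun b _ => hterm a b, Matrix.mulVec, dotProduct, Finset.mul_sum]
  refine Finset.sum_congr rfl fun b _ => ?_
  rw [← hY.integral_mul a b, ← integral_mul_const, ← integral_const_mul]
  exact integral_congr_ae (.of_forall fun ω => by ring)

theorem mulVec (hY : HasSecondMoment Y K Pr) (A : Matrix κ ι ℝ) :
    HasSecondMoment (fun ω => A *ᵥ Y ω) (A * K * Aᵀ) Pr where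
  memLp a := hY.memLp_dotProduct (A a)
  integral_mul a b := by
    rw [Matrix.mul_assoc]
    exact hY.integral_dotProduct_mul_dotProduct (A a) (A b)

theorem integral_dotProduct_eq_zero [IsFiniteMeasure Pr] (hY : HasSecondMoment Y K Pr)
    (hmean : ∀ a, ∫ ω, Y ω a ∂Pr = 0) (u : ι → ℝ) : ∫ ω, u ⬝ᵥ Y ω ∂Pr = 0 := by
  simp only [dotProduct]
  rw [integral_finsetSum _ fun a _ => (hY.integrable a).const_mul (u a)]
  simp only [integral_const_mul, hmean, mul_zero, Finset.sum_const_zero]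

theorem variance_dotProduct [IsFiniteMeasure Pr] (hY : HasSecondMoment Y K Pr)
    (hmean : ∀ a, ∫ ω, Y ω a ∂Pr = 0) (u : ι → ℝ) :
    Var[fun ω => u ⬝ᵥ Y ω; Pr] = u ⬝ᵥ (K *ᵥ u) := by
  rw [variance_of_integral_eq_zero (hY.memLp_dotProduct u).aestronglyMeasurable.aemeasurable
    (hY.integral_dotProduct_eq_zero hmean u), ← hY.integral_dotProduct_mul_dotProduct]
  simp only [sq]

end HasSecondMoment

theorem HasSecondMoment.posSemidef [Finite ι] {Y : Ω → ι → ℝ} {K : Matrix ι ι ℝ}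
    (hY : HasSecondMoment Y K Pr) : K.PosSemidef := by
  have := Fintype.ofFinite ι
  refine .of_dotProduct_mulVec_nonneg ?_ fun v => ?_
  · ext a b
    simp only [conjTranspose_apply, star_trivial, ← hY.integral_mul, mul_comm]
  · rw [star_trivial, ← hY.integral_dotProduct_mul_dotProduct]
    exact integral_nonneg fun ω => mul_self_nonneg _

section Noise

variable {γ : Measure ℝ} [IsProbabilityMeasure γ] [IsProbabilityMeasure Pr]
  {R U : Ω → ι → ℝ} {K M : Matrix ι ι ℝ} {σ : ℝ}

theorem integral_add_mul_noise (hU : HasSecondMoment U K Pr) (hR : HasSecondMoment R M Pr)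
    (hγ : MemLp id 2 γ) (hγ_mean : ∫ t, t ∂γ = 0) (a : ι) :
    ∫ p, U p.1 a + R p.1 a * p.2 ∂(Pr.prod γ) = ∫ ω, U ω a ∂Pr := by
  have hnoise : Integrable (fun p : Ω × ℝ => R p.1 a * p.2) (Pr.prod γ) :=
    (hR.integrable a).mul_prod (hγ.integrable one_le_two)
  rw [integral_add ((hU.integrable a).comp_fst γ) hnoise, integral_fun_fst (fun ω => U ω a),
    integral_prod_mul (fun ω => R ω a) (fun t : ℝ => t), hγ_mean, mul_zero, add_zero,
    probReal_univ, one_smul]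

theorem HasSecondMoment.add_mul_noise (hU : HasSecondMoment U K Pr)
    (hR : HasSecondMoment R M Pr) (hγ : MemLp id 2 γ) (hγ_mean : ∫ t, t ∂γ = 0)
    (hγ_sq : ∫ t, t ^ 2 ∂γ = σ ^ 2) :
    HasSecondMoment (fun p a => U p.1 a + R p.1 a * p.2) (K + σ ^ 2 • M) (Pr.prod γ) where
  memLp a := by
    refine ((hU.memLp a).comp_fst γ).add ?_
    have hmeas : AEStronglyMeasurable (fun p : Ω × ℝ => R p.1 a * p.2) (Pr.prod γ) :=
      (hR.memLp a).aestronglyMeasurable.comp_fst.mul measurable_snd.aestronglyMeasurable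
    rw [memLp_two_iff_integrable_sq hmeas]
    simp only [mul_pow]
    exact (hR.memLp a).integrable_sq.mul_prod hγ.integrable_sq
  integral_mul a b := by
    have hUU := (hU.integrable_mul a b).comp_fst γ
    have hUR : Integrable (fun p : Ω × ℝ => (U p.1 a * R p.1 b + R p.1 a * U p.1 b) * p.2)
        (Pr.prod γ) :=
      (((hU.memLp a).integrable_mul (hR.memLp b)).add
        ((hR.memLp a).integrable_mul (hU.memLp b))).mul_prod (hγ.integrable one_le_two)
    have hRR : Integrable (fun p : Ω × ℝ => R p.1 a * R p.1 b * p.2 ^ 2) (Pr.prod γ) :=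
      (hR.integrable_mul a b).mul_prod hγ.integrable_sq
    have hUUR : Integrable (fun p : Ω × ℝ =>
        U p.1 a * U p.1 b + (U p.1 a * R p.1 b + R p.1 a * U p.1 b) * p.2) (Pr.prod γ) :=
      hUU.add hUR
    calc ∫ p, (U p.1 a + R p.1 a * p.2) * (U p.1 b + R p.1 b * p.2) ∂(Pr.prod γ)
        = ∫ p, U p.1 a * U p.1 b + (U p.1 a * R p.1 b + R p.1 a * U p.1 b) * p.2 +
            R p.1 a * R p.1 b * p.2 ^ 2 ∂(Pr.prod γ) :=
          integral_congr_ae (.of_forall fun p => by ring)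
      _ = K a b + M a b * σ ^ 2 := by
          rw [integral_add hUUR hRR, integral_add hUU hUR,
            integral_fun_fst (fun ω => U ω a * U ω b),
            integral_prod_mul (fun ω => U ω a * R ω b + R ω a * U ω b) (fun t : ℝ => t),
            integral_prod_mul (fun ω => R ω a * R ω b) (fun t : ℝ => t ^ 2), hγ_mean, hγ_sq,
            hU.integral_mul, hR.integral_mul, mul_zero, add_zero, probReal_univ, one_smul]
      _ = (K + σ ^ 2 • M) a b := by
          rw [Matrix.add_apply, Matrix.smul_apply, smul_eq_mul, mul_comm (M a b)]

end Noise

theorem HasSecondMoment.sigma {κ : Type*} [Fintype κ] [DecidableEq κ] {l : κ → Type*}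
    {α : κ → Type*} [∀ i, MeasurableSpace (α i)] {ν : (i : κ) → Measure (α i)}
    [∀ i, IsProbabilityMeasure (ν i)] {Y : (i : κ) → α i → l i → ℝ}
    {K : (i : κ) → Matrix (l i) (l i) ℝ} (hY : ∀ i, HasSecondMoment (Y i) (K i) (ν i))
    (hmean : ∀ i a, ∫ z, Y i z a ∂(ν i) = 0) :
    HasSecondMoment (fun z (p : Σ i, l i) => Y p.1 (z p.1) p.2) (blockDiagonal' K)
      (Measure.pi ν) := by
  have hlaw : ∀ i, HasLaw (fun z : (i : κ) → α i => z i) (ν i) (Measure.pi ν) := fun i =>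
    (measurePreserving_eval ν i).hasLaw
  refine ⟨fun p => ((hY p.1).comp_hasLaw (hlaw p.1)).memLp p.2, ?_⟩
  rintro ⟨i, a⟩ ⟨j, b⟩
  obtain rfl | hij := eq_or_ne i j
  · rw [blockDiagonal'_apply_eq]
    exact ((hY i).comp_hasLaw (hlaw i)).integral_mul a b
  · have hindep : IndepFun (fun z : (i : κ) → α i => Y i (z i) a) (fun z => Y j (z j) b)
        (Measure.pi ν) := by
      have h := (iIndepFun_pi (X := fun i (z : α i) => z) (μ := ν)
        fun i => aemeasurable_id).indepFun hij
      have hmeas := fun i a => ((hY i).memLp a).aestronglyMeasurable.aemeasurable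
      exact h.comp₀ (hlaw i).aemeasurable (hlaw j).aemeasurable
        ((hlaw i).map_eq.symm ▸ hmeas i a) ((hlaw j).map_eq.symm ▸ hmeas j b)
    have hmeas := fun i a => (((hY i).comp_hasLaw (hlaw i)).memLp a).aestronglyMeasurable
    rw [blockDiagonal'_apply_ne _ _ _ hij, hindep.integral_fun_mul_eq_mul_integral
      (hmeas i a) (hmeas j b)]
    have hzero : ∫ z, Y i (z i) a ∂(Measure.pi ν) = 0 :=
      ((hlaw i).integral_comp ((hY i).memLp a).aestronglyMeasurable).trans (hmean i a)
    rw [hzero, zero_mul]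

end SecondMoments

/-! ### Scores -/

namespace View

variable {d : ℕ} (V : View d) {S : Matrix (Fin d) (Fin d) ℝ} {θ : Fin d → ℝ} {σ : ℝ}
  {μ : Measure (Fin d → ℝ)} {γ : Measure ℝ}

/-- The part `θ₋ᵀ z` of the signal that the agent cannot predict from its observed features. -/
noncomputable def hidden (S : Matrix (Fin d) (Fin d) ℝ) (θ x : Fin d → ℝ) : ℝ :=
  (V.Pminus *ᵥ θ) ⬝ᵥ V.resid S x

/-- The score `x₊ (θ₋ᵀ z + ξ)` of a sample with features `x` and noise `ξ`, i.e. its contribution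
to the error of the local normal equations at `T θ`. -/
noncomputable def score (S : Matrix (Fin d) (Fin d) ℝ) (θ : Fin d → ℝ) (p : (Fin d → ℝ) × ℝ)
    (a : Fin V.obs) : ℝ :=
  (V.Pplus *ᵥ p.1) a * (V.hidden S θ p.1 + p.2)

/-- The covariance `E[x₊ θ₋ᵀ z zᵀ θ₋ x₊ᵀ] + σ² Σ₊` of the score. -/
noncomputable def scoreCov (μ : Measure (Fin d → ℝ)) (S : Matrix (Fin d) (Fin d) ℝ)
    (θ : Fin d → ℝ) (σ : ℝ) : Matrix (Fin V.obs) (Fin V.obs) ℝ :=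
  (Matrix.of fun a b => ∫ x, V.misfit S θ a b x ∂μ) + σ ^ 2 • V.blockPlus S

theorem transpose_inv_blockPlus_mul_blockPlusMinus (hS : S.IsSymm) :
    ((V.blockPlus S)⁻¹ * V.blockPlusMinus S)ᵀ = V.blockMinusPlus S * (V.blockPlus S)⁻¹ := by
  simp only [blockPlus, blockPlusMinus, blockMinusPlus, transpose_mul, transpose_nonsing_inv,
    transpose_transpose, hS.eq, Matrix.mul_assoc]

theorem hidden_eq_dotProduct (hS : S.IsSymm) (x : Fin d → ℝ) :
    V.hidden S θ x = (θ - V.Pplusᵀ *ᵥ (V.T S *ᵥ θ)) ⬝ᵥ x := by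
  have hsplit : θ - V.Pplusᵀ *ᵥ (V.Pplus *ᵥ θ) = V.Pminusᵀ *ᵥ (V.Pminus *ᵥ θ) := by
    rw [sub_eq_iff_eq_add', mulVec_mulVec, mulVec_mulVec, ← add_mulVec,
      transpose_mul_Pplus_add_transpose_mul_Pminus, one_mulVec]
  rw [T_eq_Pplus_add, add_mulVec, mulVec_add, ← sub_sub, hsplit, ← mulVec_mulVec, hidden, resid,
    ← V.transpose_inv_blockPlus_mul_blockPlusMinus hS]
  simp only [dotProduct_sub, sub_dotProduct, mulVec_transpose, ← dotProduct_mulVec]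
  rw [dotProduct_comm (V.Pminus *ᵥ θ) (_ ᵥ* _), ← dotProduct_mulVec,
    dotProduct_comm (V.Pplus *ᵥ x)]

theorem Pplus_mulVec_mulVec_sub_eq_zero (hS : S.PosDef) :
    V.Pplus *ᵥ (S *ᵥ (θ - V.Pplusᵀ *ᵥ (V.T S *ᵥ θ))) = 0 := by
  rw [mulVec_sub, mulVec_sub, mulVec_mulVec, mulVec_mulVec, mulVec_mulVec, ← blockPlus,
    mulVec_mulVec, V.blockPlus_mul_T hS, sub_self]

theorem integral_Pplus_mulVec_mul_hidden (hS : S.PosDef)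
    (hμ : HasSecondMoment (fun x => x) S μ) (a : Fin V.obs) :
    ∫ x, (V.Pplus *ᵥ x) a * V.hidden S θ x ∂μ = 0 := by
  simp only [V.hidden_eq_dotProduct (isHermitian_iff_isSymm.1 hS.isHermitian)]
  exact (hμ.integral_dotProduct_mul_dotProduct (V.Pplus a) _).trans
    (congrFun (V.Pplus_mulVec_mulVec_sub_eq_zero hS) a)

theorem measurable_hidden : Measurable (V.hidden S θ) := by
  unfold hidden resid
  fun_prop

theorem measurable_score : Measurable (V.score S θ) := by
  have hhidden := V.measurable_hidden (S := S) (θ := θ)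
  unfold score
  fun_prop

theorem hasSecondMoment_Pplus_mul_hidden (hmisfit : ∀ a b, Integrable (V.misfit S θ a b) μ) :
    HasSecondMoment (fun x a => (V.Pplus *ᵥ x) a * V.hidden S θ x)
      (Matrix.of fun a b => ∫ x, V.misfit S θ a b x ∂μ) μ := by
  have hmul : ∀ a b x, (V.Pplus *ᵥ x) a * V.hidden S θ x * ((V.Pplus *ᵥ x) b * V.hidden S θ x) =
      V.misfit S θ a b x := fun a b x => by
    rw [misfit, hidden]
    ring
  refine ⟨fun a => ?_, fun a b => by simp only [hmul, of_apply]⟩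
  have hmeas : Measurable fun x => (V.Pplus *ᵥ x) a * V.hidden S θ x :=
    (by fun_prop : Measurable fun x => (V.Pplus *ᵥ x) a).mul V.measurable_hidden
  rw [memLp_two_iff_integrable_sq hmeas.aestronglyMeasurable]
  simp only [sq, hmul]
  exact hmisfit a a

theorem posDef_scoreCov (hS : S.PosDef) (hσ : 0 < σ)
    (hmisfit : ∀ a b, Integrable (V.misfit S θ a b) μ) : (V.scoreCov μ S θ σ).PosDef :=
  PosDef.posSemidef_add (V.hasSecondMoment_Pplus_mul_hidden hmisfit).posSemidef
    ((V.posDef_blockPlus hS).smul (pow_pos hσ 2))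

theorem posDef_Wstar (hS : S.PosDef) (hσ : 0 < σ)
    (hmisfit : ∀ a b, Integrable (V.misfit S θ a b) μ) : (V.Wstar μ S θ σ).PosDef := by
  have hB := V.posDef_blockPlus hS
  have hinj : Function.Injective fun v => v ᵥ* V.blockPlus S :=
    vecMul_injective_iff_isUnit.2 hB.isUnit
  have h := (V.posDef_scoreCov hS hσ hmisfit).inv.mul_mul_conjTranspose_same hinj
  rwa [hB.isHermitian.eq] at h

theorem inv_Wstar (hS : S.PosDef) (hσ : 0 < σ)
    (hmisfit : ∀ a b, Integrable (V.misfit S θ a b) μ) :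
    (V.Wstar μ S θ σ)⁻¹ = (V.blockPlus S)⁻¹ * V.scoreCov μ S θ σ * (V.blockPlus S)⁻¹ := by
  have hC := (isUnit_iff_isUnit_det _).1 (V.posDef_scoreCov hS hσ hmisfit).isUnit
  rw [Wstar, ← scoreCov, Matrix.mul_inv_rev, Matrix.mul_inv_rev, nonsing_inv_nonsing_inv _ hC,
    Matrix.mul_assoc]

section Noise

variable [IsProbabilityMeasure μ] [IsProbabilityMeasure γ]

theorem integral_score (hS : S.PosDef) (hμ : HasSecondMoment (fun x => x) S μ)
    (hmisfit : ∀ a b, Integrable (V.misfit S θ a b) μ) (hγ : MemLp id 2 γ)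
    (hγ_mean : ∫ t, t ∂γ = 0) (a : Fin V.obs) : ∫ p, V.score S θ p a ∂(μ.prod γ) = 0 := by
  simp only [score, mul_add]
  exact (integral_add_mul_noise (V.hasSecondMoment_Pplus_mul_hidden hmisfit)
    (hμ.mulVec V.Pplus) hγ hγ_mean a).trans (V.integral_Pplus_mulVec_mul_hidden hS hμ a)

theorem hasSecondMoment_score (hμ : HasSecondMoment (fun x => x) S μ)
    (hmisfit : ∀ a b, Integrable (V.misfit S θ a b) μ) (hγ : MemLp id 2 γ)
    (hγ_mean : ∫ t, t ∂γ = 0) (hγ_sq : ∫ t, t ^ 2 ∂γ = σ ^ 2) :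
    HasSecondMoment (V.score S θ) (V.scoreCov μ S θ σ) (μ.prod γ) := by
  have h := (V.hasSecondMoment_Pplus_mul_hidden hmisfit).add_mul_noise (hμ.mulVec V.Pplus)
    hγ hγ_mean hγ_sq
  simpa only [← mul_add] using! h

end Noise

end View

/-! ### Asymptotic normality -/

section Asymptotics

variable {Ω : Type*} [MeasurableSpace Ω] {Pr : Measure Ω}

theorem iIndepFun_curry [IsProbabilityMeasure Pr] {ι κ E : Type*} [Countable ι] [Countable κ]
    [MeasurableSpace E] {X : ι × κ → Ω → E} (hX : ∀ p, AEMeasurable (X p) Pr)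
    (hindep : iIndepFun X Pr) :
    iIndepFun (fun i ω j => X (i, j) ω) Pr := by
  have hrow : ∀ i, AEMeasurable (fun ω j => X (i, j) ω) Pr := fun i =>
    aemeasurable_pi_lambda _ fun j => hX (i, j)
  have hrow_indep : ∀ i, iIndepFun (fun j => X (i, j)) Pr := fun i =>
    hindep.precomp (Prod.mk_right_injective i)
  have hprob : ∀ p, IsProbabilityMeasure (Pr.map (X p)) := fun p =>
    Measure.isProbabilityMeasure_map (hX p)
  rw [iIndepFun_iff_map_fun_eq_infinitePi_map₀' hrow]
  simp only [fun i => (hrow_indep i).map_fun_eq_infinitePi_map₀' fun j => hX (i, j)]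
  rw [← Measure.infinitePi_map_curry fun i j => Pr.map (X (i, j)),
    ← hindep.map_fun_eq_infinitePi_map₀' hX,
    AEMeasurable.map_map_of_aemeasurable (MeasurableEquiv.measurable _).aemeasurable
      (aemeasurable_pi_lambda _ hX)]
  rfl

theorem charFun_map_eq_charFun_inner {E : Type*} [NormedAddCommGroup E] [InnerProductSpace ℝ E]
    [MeasurableSpace E] [BorelSpace E] [SecondCountableTopology E] {Y : Ω → E}
    (hY : AEMeasurable Y Pr) (t : E) :
    charFun (Pr.map Y) t = charFun (Pr.map fun ω => inner ℝ (Y ω) t) 1 := by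
  rw [charFun_apply, charFun_apply_real, integral_map hY (by fun_prop),
    integral_map (by fun_prop) (by fun_prop)]
  simp only [Complex.ofReal_one, one_mul]

section IdenticallyDistributed

variable {ι : Type*} {Y : ℕ → Ω → ι → ℝ} {K : Matrix ι ι ℝ}

theorem HasSecondMoment.ae_tendsto_smul_sum_vecMulVec [Finite ι]
    (hY : HasSecondMoment (Y 0) K Pr) (hindep : iIndepFun Y Pr)
    (hident : ∀ k, IdentDistrib (Y k) (Y 0) Pr Pr) :
    ∀ᵐ ω ∂Pr, Tendsto (fun n : ℕ => (n : ℝ)⁻¹ • ∑ k ∈ Finset.range n, vecMulVec (Y k ω) (Y k ω))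
      atTop (𝓝 K) := by
  have hentry : ∀ a b, ∀ᵐ ω ∂Pr,
      Tendsto (fun n : ℕ => (n : ℝ)⁻¹ • ∑ k ∈ Finset.range n, Y k ω a * Y k ω b)
        atTop (𝓝 (K a b)) := fun a b => by
    have hmeas : Measurable fun v : ι → ℝ => v a * v b := by fun_prop
    rw [← hY.integral_mul]
    exact strong_law_ae (fun k ω => Y k ω a * Y k ω b) (hY.integrable_mul a b)
      (fun j k hjk => (hindep.indepFun hjk).comp hmeas hmeas) fun k => (hident k).comp hmeas
  filter_upwards [ae_all_iff.2 fun a => ae_all_iff.2 (hentry a)] with ω hω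
  refine tendsto_pi_nhds.2 fun a => tendsto_pi_nhds.2 fun b => ?_
  simpa only [Matrix.smul_apply, Matrix.sum_apply, vecMulVec_apply] using hω a b

variable [Fintype ι] [IsProbabilityMeasure Pr]

theorem HasSecondMoment.tendsto_charFun_dotProduct (hY : HasSecondMoment (Y 0) K Pr)
    (hmean : ∀ a, ∫ ω, Y 0 ω a ∂Pr = 0) (hindep : iIndepFun Y Pr)
    (hident : ∀ k, IdentDistrib (Y k) (Y 0) Pr Pr) (u : ι → ℝ) :
    Tendsto (fun n : ℕ =>
        charFun (Pr.map fun ω => u ⬝ᵥ ((√(n : ℝ))⁻¹ • ∑ k ∈ Finset.range n, Y k ω)) 1)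
      atTop (𝓝 (charFun (gaussianReal 0 (u ⬝ᵥ (K *ᵥ u)).toNNReal) 1)) := by
  have hmeas : Measurable fun v : ι → ℝ => u ⬝ᵥ v := by fun_prop
  have hclt := tendstoInDistribution_inv_sqrt_mul_sum_sub (P := Pr)
    (X := fun k ω => u ⬝ᵥ Y k ω)
    (HasLaw.id (μ := gaussianReal 0 Var[fun ω => u ⬝ᵥ Y 0 ω; Pr].toNNReal))
    (hY.memLp_dotProduct u) (hindep.comp (fun _ v => u ⬝ᵥ v) fun _ => hmeas)
    fun k => (hident k).comp hmeas
  rw [hY.variance_dotProduct hmean] at hclt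
  simpa [hY.integral_dotProduct_eq_zero hmean, dotProduct_smul, dotProduct_sum] using
    ProbabilityMeasure.tendsto_iff_tendsto_charFun.1 hclt.tendsto 1

theorem HasSecondMoment.tendstoInDistribution_inv_sqrt_smul_sum [DecidableEq ι]
    (hY : HasSecondMoment (Y 0) K Pr) (hmean : ∀ a, ∫ ω, Y 0 ω a ∂Pr = 0)
    (hindep : iIndepFun Y Pr) (hident : ∀ k, IdentDistrib (Y k) (Y 0) Pr Pr) :
    TendstoInDistribution
      (fun (n : ℕ) ω => WithLp.toLp 2 ((√(n : ℝ))⁻¹ • ∑ k ∈ Finset.range n, Y k ω))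
      atTop (id : EuclideanSpace ℝ ι → EuclideanSpace ℝ ι) (fun _ => Pr)
      (multivariateGaussian 0 K) := by
  have hmeas : ∀ n : ℕ, AEMeasurable (fun ω =>
      (WithLp.toLp 2 ((√(n : ℝ))⁻¹ • ∑ k ∈ Finset.range n, Y k ω) : EuclideanSpace ℝ ι)) Pr :=
    fun n => (WithLp.measurable_toLp 2 _).comp_aemeasurable
      ((Finset.aemeasurable_fun_sum _ fun k _ => (hident k).aemeasurable_fst).fun_const_smul _)
  -- Cramér–Wold: the characteristic function at `u` only sees the scalar projections `u ⬝ᵥ Y k`.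
  refine ⟨hmeas, aemeasurable_id, ProbabilityMeasure.tendsto_iff_tendsto_charFun.2 fun u => ?_⟩
  have hnonneg : 0 ≤ u.ofLp ⬝ᵥ (K *ᵥ u.ofLp) := by
    simpa using hY.posSemidef.dotProduct_mulVec_nonneg u.ofLp
  have hlim : charFun (multivariateGaussian 0 K) u =
      charFun (gaussianReal 0 (u.ofLp ⬝ᵥ (K *ᵥ u.ofLp)).toNNReal) 1 := by
    rw [charFun_multivariateGaussian hY.posSemidef, charFun_gaussianReal,
      Real.coe_toNNReal _ hnonneg]
    simp
  simp only [ProbabilityMeasure.coe_mk, Measure.map_id, hlim,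
    fun n => charFun_map_eq_charFun_inner (hmeas n) u]
  exact hY.tendsto_charFun_dotProduct hmean hindep hident u.ofLp

end IdenticallyDistributed

theorem map_mulVec_multivariateGaussian {ι κ : Type*} [Fintype ι] [DecidableEq ι] [Fintype κ]
    [DecidableEq κ] {K : Matrix ι ι ℝ} (hK : K.PosSemidef) (A : Matrix κ ι ℝ) :
    (multivariateGaussian 0 K).map
        (fun z => (WithLp.toLp 2 (A *ᵥ WithLp.ofLp z) : EuclideanSpace ℝ κ)) =
      multivariateGaussian 0 (A * K * Aᵀ) := by
  have hcont : Continuous fun z : EuclideanSpace ℝ ι =>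
      (WithLp.toLp 2 (A *ᵥ WithLp.ofLp z) : EuclideanSpace ℝ κ) :=
    (PiLp.continuous_toLp 2 _).comp
      (continuous_const.matrix_mulVec (PiLp.continuous_ofLp 2 _))
  have hAK : (A * K * Aᵀ).PosSemidef := by simpa using hK.mul_mul_conjTranspose_same A
  have := Measure.isProbabilityMeasure_map (μ := multivariateGaussian 0 K) hcont.aemeasurable
  have hadjoint : ∀ (z : EuclideanSpace ℝ ι) (t : EuclideanSpace ℝ κ),
      inner ℝ (WithLp.toLp 2 (A *ᵥ WithLp.ofLp z) : EuclideanSpace ℝ κ) t =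
        inner ℝ z (WithLp.toLp 2 (Aᵀ *ᵥ WithLp.ofLp t) : EuclideanSpace ℝ ι) := fun z t => by
    simp only [EuclideanSpace.inner_eq_star_dotProduct, star_trivial, dotProduct_mulVec,
      mulVec_transpose]
  refine Measure.ext_of_charFun (funext fun t => ?_)
  rw [charFun_apply, integral_map hcont.aemeasurable (by fun_prop)]
  simp only [hadjoint]
  rw [← charFun_apply, charFun_multivariateGaussian hK, charFun_multivariateGaussian hAK]
  simp only [inner_zero_right, ← mulVec_mulVec, dotProduct_mulVec _ A, mulVec_transpose]

theorem tendstoInDistribution_of_map_eq [IsProbabilityMeasure Pr] {E Ω₁ Ω₂ : Type*}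
    [TopologicalSpace E] [MeasurableSpace E] [OpensMeasurableSpace E] [MeasurableSpace Ω₁]
    [MeasurableSpace Ω₂] {P₁ : Measure Ω₁} [IsProbabilityMeasure P₁] {P₂ : Measure Ω₂}
    [IsProbabilityMeasure P₂] {X : ℕ → Ω → E} {Z₁ : Ω₁ → E} {Z₂ : Ω₂ → E}
    (h : TendstoInDistribution X atTop Z₁ (fun _ => Pr) P₁) (hZ : AEMeasurable Z₂ P₂)
    (hmap : P₁.map Z₁ = P₂.map Z₂) :
    TendstoInDistribution X atTop Z₂ (fun _ => Pr) P₂ := by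
  refine ⟨h.forall_aemeasurable, hZ, ?_⟩
  have hlimit : (⟨P₁.map Z₁, Measure.isProbabilityMeasure_map h.aemeasurable_limit⟩ :
      ProbabilityMeasure E) = ⟨P₂.map Z₂, Measure.isProbabilityMeasure_map hZ⟩ :=
    Subtype.ext hmap
  exact hlimit ▸ h.tendsto

section AsymptoticallyLinear

variable {ι κ : Type*} [Fintype ι] {Y : ℕ → Ω → ι → ℝ} {K : Matrix ι ι ℝ}
  {err : ℕ → Ω → κ → ℝ} {A : Matrix κ ι ℝ}

/-- The errors `err n` of a sequence of estimators are asymptotically linear with summands `Y k` and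
coefficient matrix `A`: almost surely, for all large `n`, the error is the mean of `Y 0, …, Y (n-1)`
multiplied by a random matrix that tends to `A`. -/
structure AsymptoticallyLinear (err : ℕ → Ω → κ → ℝ) (Y : ℕ → Ω → ι → ℝ) (A : Matrix κ ι ℝ)
    (Pr : Measure Ω) : Prop where
  aemeasurable : ∀ n, AEMeasurable (err n) Pr
  exists_coeff : ∃ H : ℕ → Ω → Matrix κ ι ℝ, (∀ n a b, AEMeasurable (fun ω => H n ω a b) Pr) ∧
    (∀ᵐ ω ∂Pr, Tendsto (fun n => H n ω) atTop (𝓝 A)) ∧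
    ∀ᵐ ω ∂Pr, ∀ᶠ n : ℕ in atTop,
      err n ω = H n ω *ᵥ ((n : ℝ)⁻¹ • ∑ k ∈ Finset.range n, Y k ω)

namespace AsymptoticallyLinear

theorem ae_tendsto_zero (herr : AsymptoticallyLinear err Y A Pr) (hint : Integrable (Y 0) Pr)
    (hmean : ∫ ω, Y 0 ω ∂Pr = 0) (hindep : iIndepFun Y Pr)
    (hident : ∀ k, IdentDistrib (Y k) (Y 0) Pr Pr) :
    ∀ᵐ ω ∂Pr, Tendsto (fun n => err n ω) atTop (𝓝 0) := by
  obtain ⟨H, -, hlim, hlin⟩ := herr.exists_coeff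
  have hlln := strong_law_ae Y hint (fun _ _ hjk => hindep.indepFun hjk) hident
  filter_upwards [hlim, hlin, hlln] with ω hHω herrω hYω
  have hcont : Continuous fun q : Matrix κ ι ℝ × (ι → ℝ) => q.1 *ᵥ q.2 :=
    continuous_fst.matrix_mulVec continuous_snd
  have htendsto := (hcont.tendsto (A, 0)).comp (hHω.prodMk_nhds (hmean ▸ hYω))
  rw [mulVec_zero] at htendsto
  exact htendsto.congr' (herrω.mono fun n hn => hn.symm)

variable [IsProbabilityMeasure Pr] [Fintype κ] [DecidableEq κ]

theorem tendstoInDistribution_sqrt_smul (herr : AsymptoticallyLinear err Y A Pr)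
    (hY : HasSecondMoment (Y 0) K Pr) (hmean : ∀ a, ∫ ω, Y 0 ω a ∂Pr = 0)
    (hindep : iIndepFun Y Pr) (hident : ∀ k, IdentDistrib (Y k) (Y 0) Pr Pr) :
    TendstoInDistribution (fun (n : ℕ) ω => WithLp.toLp 2 (√(n : ℝ) • err n ω)) atTop
      (id : EuclideanSpace ℝ κ → EuclideanSpace ℝ κ) (fun _ => Pr)
      (multivariateGaussian 0 (A * K * Aᵀ)) := by
  classical
  obtain ⟨H, hHmeas, hlim, hlin⟩ := herr.exists_coeff
  have hcont : Continuous fun q : EuclideanSpace ℝ ι × (κ → ι → ℝ) =>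
      (WithLp.toLp 2 (Matrix.of q.2 *ᵥ q.1.ofLp) : EuclideanSpace ℝ κ) :=
    (PiLp.continuous_toLp 2 _).comp (Continuous.matrix_mulVec continuous_snd
      ((PiLp.continuous_ofLp 2 _).comp continuous_fst))
  have hHmeas' : ∀ n, AEMeasurable (fun ω a b => H n ω a b) Pr := fun n =>
    aemeasurable_pi_lambda _ fun a => aemeasurable_pi_lambda _ fun b => hHmeas n a b
  have hlim' : TendstoInMeasure Pr (fun n ω a b => H n ω a b) atTop fun _ a b => A a b :=
    tendstoInMeasure_of_tendsto_ae (fun n => (hHmeas' n).aestronglyMeasurable) hlim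
  have hslutsky := (hY.tendstoInDistribution_inv_sqrt_smul_sum hmean hindep hident
    ).continuous_comp_prodMk_of_tendstoInMeasure_const hcont hlim' hHmeas'
  have hmain := tendstoInDistribution_of_map_eq
    (P₂ := multivariateGaussian 0 (A * K * Aᵀ)) (Z₂ := id) hslutsky aemeasurable_id
    (Measure.map_id.symm ▸ map_mulVec_multivariateGaussian hY.posSemidef A)
  have hmeas : ∀ n : ℕ, AEMeasurable (fun ω =>
      (WithLp.toLp 2 (√(n : ℝ) • err n ω) : EuclideanSpace ℝ κ)) Pr := fun n =>
    (WithLp.measurable_toLp 2 _).comp_aemeasurable ((herr.aemeasurable n).fun_const_smul _)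
  refine tendstoInDistribution_of_tendstoInMeasure_sub _ _ hmain
    (tendstoInMeasure_of_tendsto_ae
      (fun n => ((hmeas n).sub (hmain.forall_aemeasurable n)).aestronglyMeasurable) ?_) hmeas
  filter_upwards [hlin] with ω hω
  refine tendsto_const_nhds.congr' (hω.mono fun n hn => (sub_eq_zero.2 ?_).symm)
  have hsqrt : √(n : ℝ) * (n : ℝ)⁻¹ = (√(n : ℝ))⁻¹ := by
    rw [← div_eq_mul_inv, Real.sqrt_div_self]
  simp only [hn, mulVec_smul, smul_smul, hsqrt]
  rfl

end AsymptoticallyLinear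

end AsymptoticallyLinear

section BlockRow

variable {κ k : Type*} {l : κ → Type*} [Fintype κ] [∀ i, Fintype (l i)]

/-- The block row matrix `[L₁ ⋯ Lₘ]`. -/
def blockRow (L : (i : κ) → Matrix k (l i) ℝ) : Matrix k (Σ i, l i) ℝ :=
  Matrix.of fun j p => L p.1 j p.2

theorem blockRow_mulVec (L : (i : κ) → Matrix k (l i) ℝ) (v : (Σ i, l i) → ℝ) :
    blockRow L *ᵥ v = ∑ i, L i *ᵥ fun a => v ⟨i, a⟩ := by
  ext j
  simp only [blockRow, mulVec, dotProduct, Fintype.sum_sigma, Matrix.of_apply, Finset.sum_apply]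

theorem blockRow_mul_blockDiagonal'_mul_transpose [DecidableEq κ]
    (L : (i : κ) → Matrix k (l i) ℝ) (K : (i : κ) → Matrix (l i) (l i) ℝ) :
    blockRow L * blockDiagonal' K * (blockRow L)ᵀ = combinedCov L K := by
  have hmul : blockRow L * blockDiagonal' K = blockRow fun i => L i * K i := by
    ext j ⟨i, b⟩
    simp only [Matrix.mul_apply, Fintype.sum_sigma, blockRow, Matrix.of_apply]
    rw [Finset.sum_eq_single_of_mem i (Finset.mem_univ i) fun i' _ hi' =>
      Finset.sum_eq_zero fun a _ => by rw [blockDiagonal'_apply_ne _ _ _ hi', mul_zero]]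
    simp only [blockDiagonal'_apply_eq]
  rw [hmul]
  ext j j'
  simp only [combinedCov, Matrix.sum_apply, Matrix.mul_apply, Fintype.sum_sigma, blockRow,
    Matrix.of_apply, transpose_apply]

end BlockRow

end Asymptotics

/-! ### The estimators from i.i.d. samples -/

namespace View

variable {d : ℕ} (V : View d) {S : Matrix (Fin d) (Fin d) ℝ}

theorem dataPlus_apply {n : ℕ} (X : Matrix (Fin n) (Fin d) ℝ) (k : Fin n) (a : Fin V.obs) :
    V.dataPlus X k a = (V.Pplus *ᵥ X k) a := by
  simp [dataPlus, Pplus, Matrix.mul_apply, mulVec, dotProduct]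

/-- The empirical matrix of second moments `X₊ᵀ X₊ / n` of the observed features, from the first
`n` of the feature vectors `z`. -/
noncomputable def empiricalMoment (z : ℕ → Fin d → ℝ) (n : ℕ) :
    Matrix (Fin V.obs) (Fin V.obs) ℝ :=
  (n : ℝ)⁻¹ • ∑ k ∈ Finset.range n, vecMulVec (V.Pplus *ᵥ z k) (V.Pplus *ᵥ z k)

theorem ae_tendsto_empiricalMoment {Ω : Type*} [MeasurableSpace Ω] {Pr : Measure Ω}
    {μ : Measure (Fin d → ℝ)} (hμ : HasSecondMoment (fun v => v) S μ) {z : ℕ → Ω → Fin d → ℝ}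
    (hz : ∀ k, HasLaw (z k) μ Pr) (hindep : iIndepFun z Pr) :
    ∀ᵐ ω ∂Pr, Tendsto (V.empiricalMoment fun k => z k ω) atTop (𝓝 (V.blockPlus S)) := by
  have hmeas : Measurable fun v : Fin d → ℝ => V.Pplus *ᵥ v := by fun_prop
  exact HasSecondMoment.ae_tendsto_smul_sum_vecMulVec ((hμ.comp_hasLaw (hz 0)).mulVec V.Pplus)
    (hindep.comp (fun _ v => V.Pplus *ᵥ v) fun _ => hmeas)
    fun k => ((hz k).identDistrib (hz 0)).comp hmeas

end View

section Samples

variable {Ω : Type*} {d m : ℕ} {V : Fin m → View d} {S : Matrix (Fin d) (Fin d) ℝ}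
  {θ : Fin d → ℝ} {σ : ℝ} {x : Fin m → ℕ → Ω → Fin d → ℝ} {ξ : Fin m → ℕ → Ω → ℝ}
  {W : Fin m → Matrix (Fin d) (Fin d) ℝ}

theorem transpose_dataPlus_mul_dataPlus (i : Fin m) (n : ℕ) (ω : Ω) :
    ((V i).dataPlus (dataMat x i n ω))ᵀ * (V i).dataPlus (dataMat x i n ω) =
      (n : ℝ) • (V i).empiricalMoment (fun k => x i k ω) n := by
  obtain rfl | hn := eq_or_ne n 0
  · ext a b
    simp [Matrix.mul_apply]
  rw [View.empiricalMoment, smul_inv_smul₀ (Nat.cast_ne_zero.2 hn), Finset.sum_range]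
  ext a b
  simp only [Matrix.mul_apply, transpose_apply, View.dataPlus_apply, Matrix.sum_apply,
    vecMulVec_apply]
  rfl

theorem transpose_dataPlus_mulVec_labels_sub (hS : S.IsSymm) (i : Fin m) (n : ℕ) (ω : Ω) :
    ((V i).dataPlus (dataMat x i n ω))ᵀ *ᵥ
        (labels x ξ θ i n ω - (V i).dataPlus (dataMat x i n ω) *ᵥ ((V i).T S *ᵥ θ)) =
      ∑ k ∈ Finset.range n, (V i).score S θ (x i k ω, ξ i k ω) := by
  have hresidual : labels x ξ θ i n ω -
      (V i).dataPlus (dataMat x i n ω) *ᵥ ((V i).T S *ᵥ θ) =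
        fun k : Fin n => (V i).hidden S θ (x i k ω) + ξ i k ω := by
    funext k
    rw [View.dataPlus, ← mulVec_mulVec, labels, add_sub_right_comm, ← mulVec_sub,
      (V i).hidden_eq_dotProduct hS, dotProduct_comm]
    rfl
  ext a
  rw [hresidual, Finset.sum_range]
  simp only [mulVec, dotProduct, transpose_apply, View.dataPlus_apply, Finset.sum_apply,
    View.score]
  rfl

theorem olsEst_sub_T_mulVec (hS : S.IsSymm) {i : Fin m} {n : ℕ} {ω : Ω}
    (hX : IsUnit (((V i).dataPlus (dataMat x i n ω))ᵀ * (V i).dataPlus (dataMat x i n ω)).det) :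
    olsEst V x ξ θ i n ω - (V i).T S *ᵥ θ =
      pinv ((V i).empiricalMoment (fun k => x i k ω) n) *ᵥ
        ((n : ℝ)⁻¹ • ∑ k ∈ Finset.range n, (V i).score S θ (x i k ω, ξ i k ω)) := by
  rw [olsEst, View.ols_sub _ _ _ hX, transpose_dataPlus_mulVec_labels_sub hS,
    transpose_dataPlus_mul_dataPlus, pinv_smul, smul_mulVec, mulVec_smul]

theorem impEst_eq_of_rank_eq {i : Fin m} {n : ℕ} {ω : Ω}
    (hrank : ((V i).dataPlus (dataMat x i n ω)).rank = (V i).obs) :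
    impEst V S x ξ θ i n ω = (V i).Tlift S *ᵥ olsEst V x ξ θ i n ω := by
  refine (V i).imp_eq_Tlift_mulVec_ols _
    ((rank_eq_card_iff_isUnit_det_transpose_mul_self _).1 ?_)
  rw [hrank, Fintype.card_fin]

variable [MeasurableSpace Ω] {Pr : Measure Ω} {μ : Measure (Fin d → ℝ)}

theorem ae_eventually_isUnit_det_transpose_dataPlus_mul_dataPlus (hS : S.PosDef)
    (hμ : HasSecondMoment (fun v => v) S μ) {i : Fin m} (hx : ∀ k, HasLaw (x i k) μ Pr)
    (hindep : iIndepFun (x i) Pr) :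
    ∀ᵐ ω ∂Pr, ∀ᶠ n in atTop,
      IsUnit (((V i).dataPlus (dataMat x i n ω))ᵀ * (V i).dataPlus (dataMat x i n ω)).det := by
  filter_upwards [(V i).ae_tendsto_empiricalMoment hμ hx hindep] with ω hω
  have hdet := (continuous_id.matrix_det.tendsto _).comp hω
  filter_upwards [hdet.eventually_ne ((V i).isUnit_det_blockPlus hS).ne_zero,
    eventually_ne_atTop 0] with n hn hn0
  rw [transpose_dataPlus_mul_dataPlus, det_smul]
  exact (mul_ne_zero (pow_ne_zero _ (Nat.cast_ne_zero.2 hn0)) hn).isUnit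

theorem ae_eventually_rank_dataPlus (hS : S.PosDef) (hμ : HasSecondMoment (fun v => v) S μ)
    {i : Fin m} (hx : ∀ k, HasLaw (x i k) μ Pr) (hindep : iIndepFun (x i) Pr) :
    ∀ᵐ ω ∂Pr, ∀ᶠ n in atTop, ((V i).dataPlus (dataMat x i n ω)).rank = (V i).obs := by
  filter_upwards [ae_eventually_isUnit_det_transpose_dataPlus_mul_dataPlus (V := V) hS hμ hx
    hindep] with ω hω
  filter_upwards [hω] with n hn
  rw [(rank_eq_card_iff_isUnit_det_transpose_mul_self _).2 hn, Fintype.card_fin]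

theorem ae_tendsto_pinv_empiricalMoment (hS : S.PosDef)
    (hμ : HasSecondMoment (fun v => v) S μ) {i : Fin m} (hx : ∀ k, HasLaw (x i k) μ Pr)
    (hindep : iIndepFun (x i) Pr) :
    ∀ᵐ ω ∂Pr, Tendsto (fun n => pinv ((V i).empiricalMoment (fun k => x i k ω) n)) atTop
      (𝓝 ((V i).blockPlus S)⁻¹) := by
  have hB := (V i).isUnit_det_blockPlus hS
  filter_upwards [(V i).ae_tendsto_empiricalMoment hμ hx hindep] with ω hω
  rw [← (isMoorePenrose_nonsing_inv hB).pinv_eq]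
  exact (continuousAt_pinv hB).tendsto.comp hω

theorem aemeasurable_impEst {i : Fin m} (hx : ∀ k, AEMeasurable (x i k) Pr)
    (hξ : ∀ k, AEMeasurable (ξ i k) Pr) (n : ℕ) : AEMeasurable (impEst V S x ξ θ i n) Pr := by
  have hdata : ∀ (k : Fin n) (j : Fin d), AEMeasurable (fun ω => dataMat x i n ω k j) Pr :=
    fun k j => aemeasurable_pi_iff.1 (hx k) j
  have hlabels : ∀ k, AEMeasurable (fun ω => labels x ξ θ i n ω k) Pr := fun k =>
    (aemeasurable_mulVec (v := fun _ => θ) hdata (fun _ => aemeasurable_const) k).add (hξ k)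
  have hplus : ∀ k a, AEMeasurable (fun ω => (V i).dataPlus (dataMat x i n ω) k a) Pr :=
    aemeasurable_matrix_mul (B := fun _ => (V i).Pplusᵀ) hdata fun _ _ => aemeasurable_const
  have hplusT : ∀ k a, AEMeasurable
      (fun ω => ((V i).dataPlus (dataMat x i n ω) * (V i).T S) k a) Pr :=
    aemeasurable_matrix_mul (B := fun _ => (V i).T S) hplus fun _ _ => aemeasurable_const
  refine aemeasurable_pi_lambda _ fun j => ?_
  simp only [impEst, View.imp_eq_pinv_mulVec]
  exact aemeasurable_mulVec (aemeasurable_pinv hplusT) hlabels j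

theorem Admissible.aemeasurable_aggEst (hW : Admissible V S W)
    (hx : ∀ i k, AEMeasurable (x i k) Pr) (hξ : ∀ i k, AEMeasurable (ξ i k) Pr) (n : ℕ) :
    AEMeasurable (aggEst V S W x ξ θ n) Pr := by
  refine aemeasurable_pi_lambda _ fun j => ?_
  simp only [aggEst, hW.argmin_impLoss, wlsSol, Finset.sum_apply]
  exact Finset.aemeasurable_fun_sum _ fun i _ => aemeasurable_mulVec
    (A := fun _ => wlsGain (fun i => (V i).Tlift S * (V i).T S) W i) (fun _ _ => aemeasurable_const)
    (aemeasurable_pi_iff.1 (aemeasurable_impEst (hx i) (hξ i) n)) j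

theorem aemeasurable_empiricalMoment {i : Fin m} (hx : ∀ k, AEMeasurable (x i k) Pr) (n : ℕ)
    (a b : Fin (V i).obs) :
    AEMeasurable (fun ω => (V i).empiricalMoment (fun k => x i k ω) n a b) Pr := by
  have hobs : ∀ k a, AEMeasurable (fun ω => ((V i).Pplus *ᵥ x i k ω) a) Pr := fun k =>
    aemeasurable_mulVec (A := fun _ => (V i).Pplus) (fun _ _ => aemeasurable_const)
      (aemeasurable_pi_iff.1 (hx k))
  simp only [View.empiricalMoment, Matrix.smul_apply, Matrix.sum_apply, vecMulVec_apply,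
    smul_eq_mul]
  exact (Finset.aemeasurable_fun_sum _ fun k _ => (hobs k a).mul (hobs k b)).const_mul _

/-- The scores of all agents stacked into one vector, for one sample `(x, ξ)` of each agent. -/
noncomputable def stackedScore (V : Fin m → View d) (S : Matrix (Fin d) (Fin d) ℝ)
    (θ : Fin d → ℝ) (p : Fin m → (Fin d → ℝ) × ℝ) (q : Σ i, Fin (V i).obs) : ℝ :=
  (V q.1).score S θ (p q.1) q.2

theorem measurable_stackedScore : Measurable (stackedScore V S θ) :=
  measurable_pi_lambda _ fun q =>
    (measurable_pi_apply q.2).comp ((V q.1).measurable_score.comp (measurable_pi_apply q.1))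

theorem Admissible.asymptoticallyLinear_aggEst_sub (hW : Admissible V S W) (hS : S.PosDef)
    (hμ : HasSecondMoment (fun v => v) S μ) (hx : ∀ i k, HasLaw (x i k) μ Pr)
    (hξ : ∀ i k, AEMeasurable (ξ i k) Pr) (hindep : ∀ i, iIndepFun (x i) Pr) :
    AsymptoticallyLinear (fun n ω => aggEst V S W x ξ θ n ω - θ)
      (fun k ω => stackedScore V S θ fun i => (x i k ω, ξ i k ω))
      (blockRow fun i => aggGain V S W i * ((V i).blockPlus S)⁻¹) Pr where
  aemeasurable n := (hW.aemeasurable_aggEst (fun i k => (hx i k).aemeasurable) hξ n).sub_const θ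
  exists_coeff := by
    refine ⟨fun n ω => blockRow fun i =>
      aggGain V S W i * pinv ((V i).empiricalMoment (fun k => x i k ω) n), ?_, ?_, ?_⟩
    · rintro n a ⟨i, b⟩
      exact aemeasurable_matrix_mul (A := fun _ => aggGain V S W i)
        (fun _ _ => aemeasurable_const) (aemeasurable_pinv
          (aemeasurable_empiricalMoment (fun k => (hx i k).aemeasurable) n)) a b
    · filter_upwards [ae_all_iff.2 fun i =>
        ae_tendsto_pinv_empiricalMoment (V := V) hS hμ (hx i) (hindep i)] with ω hω
      refine tendsto_pi_nhds.2 fun a => tendsto_pi_nhds.2 fun ⟨i, b⟩ => ?_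
      have hmul := ((continuous_const (y := aggGain V S W i)).matrix_mul continuous_id).tendsto
        ((V i).blockPlus S)⁻¹
      exact ((hmul.comp (hω i)).apply_nhds a).apply_nhds b
    · filter_upwards [ae_all_iff.2 fun i =>
        ae_eventually_isUnit_det_transpose_dataPlus_mul_dataPlus (V := V) hS hμ (hx i)
          (hindep i)] with ω hω
      filter_upwards [eventually_all.2 hω] with n hn
      have himp : ∀ i, impEst V S x ξ θ i n ω = (V i).Tlift S *ᵥ olsEst V x ξ θ i n ω := fun i =>
        (V i).imp_eq_Tlift_mulVec_ols _ (hn i)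
      simp only [aggEst, himp]
      rw [hW.argmin_impLoss_sub, blockRow_mulVec]
      refine Finset.sum_congr rfl fun i _ => ?_
      rw [olsEst_sub_T_mulVec (isHermitian_iff_isSymm.1 hS.isHermitian) (hn i), mulVec_mulVec]
      congr 1
      ext a
      simp only [Pi.smul_apply, Finset.sum_apply, stackedScore]

theorem blockRow_aggGain_mul_blockDiagonal'_scoreCov (hS : S.PosDef) (hσ : 0 < σ)
    (hmisfit : ∀ i a b, Integrable ((V i).misfit S θ a b) μ) :
    (blockRow fun i => aggGain V S W i * ((V i).blockPlus S)⁻¹) *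
        blockDiagonal' (fun i => (V i).scoreCov μ S θ σ) *
        (blockRow fun i => aggGain V S W i * ((V i).blockPlus S)⁻¹)ᵀ =
      aggCov V S (fun i => (V i).Wstar μ S θ σ) W := by
  rw [blockRow_mul_blockDiagonal'_mul_transpose, aggCov]
  refine Finset.sum_congr rfl fun i _ => ?_
  have hsymm : (((V i).blockPlus S)⁻¹)ᵀ = ((V i).blockPlus S)⁻¹ :=
    isHermitian_iff_isSymm.1 ((V i).posDef_blockPlus hS).inv.isHermitian
  beta_reduce
  rw [(V i).inv_Wstar hS hσ (hmisfit i), transpose_mul, hsymm]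
  simp only [Matrix.mul_assoc]

/-- The sampling model: the pairs of features and noise, over all agents and samples, are i.i.d.
with law `μ ⊗ γ`. -/
structure IsIIDSample (x : Fin m → ℕ → Ω → Fin d → ℝ) (ξ : Fin m → ℕ → Ω → ℝ)
    (μ : Measure (Fin d → ℝ)) (γ : Measure ℝ) (Pr : Measure Ω) : Prop where
  hasLaw_pair : ∀ i k, HasLaw (fun ω => (x i k ω, ξ i k ω)) (μ.prod γ) Pr
  iIndepFun_pair : iIndepFun (fun (p : Fin m × ℕ) ω => (x p.1 p.2 ω, ξ p.1 p.2 ω)) Pr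

section Noise

variable {γ : Measure ℝ}

namespace IsIIDSample

theorem aemeasurable_noise (h : IsIIDSample x ξ μ γ Pr) (i : Fin m) (k : ℕ) :
    AEMeasurable (ξ i k) Pr :=
  (h.hasLaw_pair i k).aemeasurable.snd

theorem iIndepFun_features (h : IsIIDSample x ξ μ γ Pr) (i : Fin m) : iIndepFun (x i) Pr :=
  (h.iIndepFun_pair.precomp (Prod.mk_right_injective i)).comp (fun _ p => p.1)
    fun _ => measurable_fst

theorem hasLaw_pi (h : IsIIDSample x ξ μ γ Pr) (k : ℕ) :
    HasLaw (fun ω i => (x i k ω, ξ i k ω)) (Measure.pi fun _ => μ.prod γ) Pr :=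
  (h.iIndepFun_pair.precomp (Prod.mk_left_injective k)).hasLaw_pi fun i => h.hasLaw_pair i k

theorem identDistrib_stackedScore (h : IsIIDSample x ξ μ γ Pr) (k : ℕ) :
    IdentDistrib (fun ω => stackedScore V S θ fun i => (x i k ω, ξ i k ω))
      (fun ω => stackedScore V S θ fun i => (x i 0 ω, ξ i 0 ω)) Pr Pr :=
  ((h.hasLaw_pi k).identDistrib (h.hasLaw_pi 0)).comp measurable_stackedScore

theorem iIndepFun_stackedScore [IsProbabilityMeasure Pr] (h : IsIIDSample x ξ μ γ Pr) :
    iIndepFun (fun k ω => stackedScore V S θ fun i => (x i k ω, ξ i k ω)) Pr :=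
  (iIndepFun_curry (fun p : ℕ × Fin m => (h.hasLaw_pair p.2 p.1).aemeasurable)
    (h.iIndepFun_pair.precomp Prod.swap_injective)).comp (fun _ => stackedScore V S θ)
    fun _ => measurable_stackedScore

theorem hasLaw_features [IsProbabilityMeasure γ] (h : IsIIDSample x ξ μ γ Pr) (i : Fin m)
    (k : ℕ) : HasLaw (x i k) μ Pr :=
  measurePreserving_fst.hasLaw.comp (h.hasLaw_pair i k)

variable [IsProbabilityMeasure μ] [IsProbabilityMeasure γ]

theorem integral_stackedScore (h : IsIIDSample x ξ μ γ Pr) (hS : S.PosDef)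
    (hμ : HasSecondMoment (fun v => v) S μ)
    (hmisfit : ∀ i a b, Integrable ((V i).misfit S θ a b) μ) (hγ : MemLp id 2 γ)
    (hγ_mean : ∫ t, t ∂γ = 0) (k : ℕ) (q : Σ i, Fin (V i).obs) :
    ∫ ω, stackedScore V S θ (fun i => (x i k ω, ξ i k ω)) q ∂Pr = 0 :=
  ((h.hasLaw_pair q.1 k).integral_comp
    ((measurable_pi_apply q.2).comp (V q.1).measurable_score).aestronglyMeasurable).trans
    ((V q.1).integral_score hS hμ (hmisfit q.1) hγ hγ_mean q.2)

theorem hasSecondMoment_stackedScore (h : IsIIDSample x ξ μ γ Pr) (hS : S.PosDef)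
    (hμ : HasSecondMoment (fun v => v) S μ)
    (hmisfit : ∀ i a b, Integrable ((V i).misfit S θ a b) μ) (hγ : MemLp id 2 γ)
    (hγ_mean : ∫ t, t ∂γ = 0) (hγ_sq : ∫ t, t ^ 2 ∂γ = σ ^ 2) (k : ℕ) :
    HasSecondMoment (fun ω => stackedScore V S θ fun i => (x i k ω, ξ i k ω))
      (blockDiagonal' fun i => (V i).scoreCov μ S θ σ) Pr :=
  (HasSecondMoment.sigma
    (fun i => (V i).hasSecondMoment_score hμ (hmisfit i) hγ hγ_mean hγ_sq)
    fun i => (V i).integral_score hS hμ (hmisfit i) hγ hγ_mean).comp_hasLaw (h.hasLaw_pi k)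

theorem integrable_stackedScore [IsFiniteMeasure Pr] (h : IsIIDSample x ξ μ γ Pr) (hS : S.PosDef)
    (hμ : HasSecondMoment (fun v => v) S μ)
    (hmisfit : ∀ i a b, Integrable ((V i).misfit S θ a b) μ) (hγ : MemLp id 2 γ)
    (hγ_mean : ∫ t, t ∂γ = 0) (k : ℕ) (q : Σ i, Fin (V i).obs) :
    Integrable (fun ω => stackedScore V S θ (fun i => (x i k ω, ξ i k ω)) q) Pr :=
  (h.hasSecondMoment_stackedScore hS hμ hmisfit hγ hγ_mean
    (Real.sq_sqrt (integral_nonneg fun t => sq_nonneg t)).symm k).integrable q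

variable [IsProbabilityMeasure Pr]

theorem tendstoInMeasure_aggEst (h : IsIIDSample x ξ μ γ Pr) (hW : Admissible V S W)
    (hS : S.PosDef) (hμ : HasSecondMoment (fun v => v) S μ)
    (hmisfit : ∀ i a b, Integrable ((V i).misfit S θ a b) μ) (hγ : MemLp id 2 γ)
    (hγ_mean : ∫ t, t ∂γ = 0) :
    TendstoInMeasure Pr (fun n ω => aggEst V S W x ξ θ n ω) atTop fun _ => θ := by
  have hint := h.integrable_stackedScore hS hμ hmisfit hγ hγ_mean 0
  have hmean : ∫ ω, stackedScore V S θ (fun i => (x i 0 ω, ξ i 0 ω)) ∂Pr = 0 := by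
    ext q
    rw [eval_integral hint, h.integral_stackedScore hS hμ hmisfit hγ hγ_mean, Pi.zero_apply]
  have herr := (hW.asymptoticallyLinear_aggEst_sub (θ := θ) hS hμ h.hasLaw_features
    h.aemeasurable_noise h.iIndepFun_features).ae_tendsto_zero (.of_eval hint) hmean
    h.iIndepFun_stackedScore h.identDistrib_stackedScore
  refine tendstoInMeasure_of_tendsto_ae (fun n => (hW.aemeasurable_aggEst
    (fun i k => (h.hasLaw_features i k).aemeasurable) h.aemeasurable_noise n).aestronglyMeasurable)
    ?_
  filter_upwards [herr] with ω hω
  simpa only [sub_add_cancel, zero_add] using hω.add_const θ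

theorem tendstoInDistribution_aggEst (h : IsIIDSample x ξ μ γ Pr) (hW : Admissible V S W)
    (hS : S.PosDef) (hμ : HasSecondMoment (fun v => v) S μ)
    (hmisfit : ∀ i a b, Integrable ((V i).misfit S θ a b) μ) (hσ : 0 < σ) (hγ : MemLp id 2 γ)
    (hγ_mean : ∫ t, t ∂γ = 0) (hγ_sq : ∫ t, t ^ 2 ∂γ = σ ^ 2) :
    TendstoInDistribution
      (fun (n : ℕ) ω => WithLp.toLp 2 (√(n : ℝ) • (aggEst V S W x ξ θ n ω - θ))) atTop
      (id : EuclideanSpace ℝ (Fin d) → EuclideanSpace ℝ (Fin d)) (fun _ => Pr)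
      (multivariateGaussian 0 (aggCov V S (fun i => (V i).Wstar μ S θ σ) W)) := by
  rw [← blockRow_aggGain_mul_blockDiagonal'_scoreCov hS hσ hmisfit]
  exact (hW.asymptoticallyLinear_aggEst_sub hS hμ h.hasLaw_features h.aemeasurable_noise
    h.iIndepFun_features).tendstoInDistribution_sqrt_smul
    (h.hasSecondMoment_stackedScore hS hμ hmisfit hγ hγ_mean hγ_sq 0)
    (h.integral_stackedScore hS hμ hmisfit hγ hγ_mean 0) h.iIndepFun_stackedScore
    h.identDistrib_stackedScore

end IsIIDSample

end Noise

end Samples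

theorem integral_sq_gaussianReal_zero (v : NNReal) : ∫ t, t ^ 2 ∂(gaussianReal 0 v) = v := by
  have h := variance_id_gaussianReal (μ := 0) (v := v)
  rwa [variance_of_integral_eq_zero aemeasurable_id integral_id_gaussianReal] at h

end CollabLS

open CollabLS

theorem mainTheorem6_general {Ω : Type*} [MeasurableSpace Ω] (Pr : Measure Ω)
    [IsProbabilityMeasure Pr] (d m : ℕ) (V : Fin m → View d)
    (hcover : ∀ j : Fin d, ∃ i : Fin m, ∃ a : Fin (V i).obs, (V i).perm (Sum.inl a) = j)
    (μ : Measure (Fin d → ℝ)) [IsProbabilityMeasure μ]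
    (S : Matrix (Fin d) (Fin d) ℝ) (hS : S.PosDef)
    (hmem : ∀ j, MemLp (fun v : Fin d → ℝ => v j) 2 μ)
    (hcov : ∀ j k, ∫ v, v j * v k ∂μ = S j k)
    (θ : Fin d → ℝ) (σ : ℝ) (hσ : 0 < σ)
    (hmisfit : ∀ i a b, Integrable ((V i).misfit S θ a b) μ)
    (γ : Measure ℝ) [IsProbabilityMeasure γ] (hγ : MemLp id 2 γ)
    (hγ_mean : ∫ t, t ∂γ = 0) (hγ_sq : ∫ t, t ^ 2 ∂γ = σ ^ 2)
    (x : Fin m → ℕ → Ω → (Fin d → ℝ)) (ξ : Fin m → ℕ → Ω → ℝ)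
    (hlaw : ∀ i k, HasLaw (fun ω => (x i k ω, ξ i k ω)) (μ.prod γ) Pr)
    (hindep : iIndepFun (fun (p : Fin m × ℕ) (ω : Ω) => (x p.1 p.2 ω, ξ p.1 p.2 ω)) Pr) :
    (∀ i n ω, ((V i).dataPlus (dataMat x i n ω)).rank = (V i).obs →
      impEst V S x ξ θ i n ω =
        (((V i).T S)ᵀ * ((V i).T S * ((V i).T S)ᵀ)⁻¹) *ᵥ olsEst V x ξ θ i n ω) ∧
    (∀ i, ∀ᵐ ω ∂Pr, ∀ᶠ n in atTop,
      ((V i).dataPlus (dataMat x i n ω)).rank = (V i).obs ∧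
      impEst V S x ξ θ i n ω =
        (((V i).T S)ᵀ * ((V i).T S * ((V i).T S)ᵀ)⁻¹) *ᵥ olsEst V x ξ θ i n ω) ∧
    (∀ W : Fin m → Matrix (Fin d) (Fin d) ℝ, (∀ i, (W i).PosDef) → Admissible V S W) ∧
    Admissible V S (fun i => ((V i).T S)ᵀ * (V i).Wstar μ S θ σ * (V i).T S) ∧
    (∑ i, ((V i).T S)ᵀ * (V i).Wstar μ S θ σ * (V i).T S).PosDef ∧
    ∃ Cimp : (Fin m → Matrix (Fin d) (Fin d) ℝ) → Matrix (Fin d) (Fin d) ℝ,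
      (∀ W : Fin m → Matrix (Fin d) (Fin d) ℝ, Admissible V S W →
        (∀ n ω, ∃! t : Fin d → ℝ, ∀ t' : Fin d → ℝ,
          impLoss V S W (fun i => impEst V S x ξ θ i n ω) t ≤
            impLoss V S W (fun i => impEst V S x ξ θ i n ω) t') ∧
        TendstoInMeasure Pr (fun n ω => aggEst V S W x ξ θ n ω) atTop (fun _ => θ) ∧
        (Cimp W).PosSemidef ∧
        TendstoInDistribution
          (fun (n : ℕ) (ω : Ω) =>
            (WithLp.toLp 2 (√(n : ℝ) • (aggEst V S W x ξ θ n ω - θ)) : EuclideanSpace ℝ (Fin d)))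
          atTop (id : EuclideanSpace ℝ (Fin d) → EuclideanSpace ℝ (Fin d))
          (fun _ => Pr) (multivariateGaussian 0 (Cimp W)) ∧
        (Cimp W - Cstar V μ S θ σ).PosSemidef) ∧
      Cimp (fun i => ((V i).T S)ᵀ * (V i).Wstar μ S θ σ * (V i).T S) = Cstar V μ S θ σ := by
  have hμ : HasSecondMoment (fun v => v) S μ := ⟨hmem, hcov⟩
  have hsample : IsIIDSample x ξ μ γ Pr := ⟨hlaw, hindep⟩
  have hU : ∀ i, ((V i).Wstar μ S θ σ).PosDef := fun i => (V i).posDef_Wstar hS hσ (hmisfit i)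
  have hM := posDef_normalMatrix_T hcover hS hU
  refine ⟨fun _ _ _ => impEst_eq_of_rank_eq, fun i => ?_,
    fun W hW => admissible_of_posDef hcover hS hW, admissible_transpose_mul_mul_T hcover hS hU, hM,
    aggCov V S fun i => (V i).Wstar μ S θ σ, fun W hW => ⟨?_, ?_, ?_, ?_, ?_⟩,
    aggCov_transpose_mul_mul_T hU hM⟩
  · filter_upwards [ae_eventually_rank_dataPlus hS hμ (hsample.hasLaw_features i)
      (hsample.iIndepFun_features i)] with ω hω
    exact hω.mono fun n hrank => ⟨hrank, impEst_eq_of_rank_eq hrank⟩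
  · exact fun n ω => hW.existsUnique_forall_impLoss_le _
  · exact hsample.tendstoInMeasure_aggEst hW hS hμ hmisfit hγ hγ_mean
  · exact posSemidef_aggCov hU
  · exact hsample.tendstoInDistribution_aggEst hW hS hμ hmisfit hσ hγ hγ_mean hγ_sq
  · exact hW.posSemidef_aggCov_sub hU hM

theorem mainTheorem6 {Ω : Type*} [MeasurableSpace Ω] (Pr : Measure Ω) [IsProbabilityMeasure Pr]
    (d m : ℕ) (V : Fin m → View d)
    -- every feature is observed by at least one agent
    (hcover : ∀ j : Fin d, ∃ i : Fin m, ∃ a : Fin (V i).obs, (V i).perm (Sum.inl a) = j)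
    -- law `μ` of the features: mean zero, covariance `S ≻ 0`
    (μ : Measure (Fin d → ℝ)) [IsProbabilityMeasure μ]
    (S : Matrix (Fin d) (Fin d) ℝ) (hS : S.PosDef)
    (hmem : ∀ j, MemLp (fun v : Fin d → ℝ => v j) 2 μ)
    (hmean : ∀ j, ∫ v, v j ∂μ = 0)
    (hcov : ∀ j k, ∫ v, v j * v k ∂μ = S j k)
    -- true parameter and noise level
    (θ : Fin d → ℝ) (σ : ℝ) (hσ : 0 < σ)
    -- the expectations in the definition of the weights `Wᵢ⋆` exist
    (hmisfit : ∀ i a b, Integrable ((V i).misfit S θ a b) μ)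
    -- features `x i k` and noise `ξ i k` of sample `k` of agent `i`
    (x : Fin m → ℕ → Ω → (Fin d → ℝ)) (ξ : Fin m → ℕ → Ω → ℝ)
    (hx : ∀ i k, HasLaw (x i k) μ Pr)
    (hξ : ∀ i k, HasLaw (ξ i k) (gaussianReal 0 (σ ^ 2).toNNReal) Pr)
    (hxξ : ∀ i k, IndepFun (x i k) (ξ i k) Pr)
    (hindep : iIndepFun (fun (p : Fin m × ℕ) (ω : Ω) => (x p.1 p.2 ω, ξ p.1 p.2 ω)) Pr) :
    -- the local imputation estimator is a linear transform of local OLS, as soon as the observed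
    -- data matrix has full column rank, and almost surely for all large `n`
    (∀ i n ω, ((V i).dataPlus (dataMat x i n ω)).rank = (V i).obs →
      impEst V S x ξ θ i n ω =
        (((V i).T S)ᵀ * ((V i).T S * ((V i).T S)ᵀ)⁻¹) *ᵥ olsEst V x ξ θ i n ω) ∧
    (∀ i, ∀ᵐ ω ∂Pr, ∀ᶠ n in atTop,
      ((V i).dataPlus (dataMat x i n ω)).rank = (V i).obs ∧
      impEst V S x ξ θ i n ω =
        (((V i).T S)ᵀ * ((V i).T S * ((V i).T S)ᵀ)⁻¹) *ᵥ olsEst V x ξ θ i n ω) ∧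
    -- positive definite weights, and the weights `Tᵢᵀ Wᵢ⋆ Tᵢ`, are admissible
    (∀ W : Fin m → Matrix (Fin d) (Fin d) ℝ, (∀ i, (W i).PosDef) → Admissible V S W) ∧
    Admissible V S (fun i => ((V i).T S)ᵀ * (V i).Wstar μ S θ σ * (V i).T S) ∧
    -- `C⋆` is the inverse of an invertible matrix
    (∑ i, ((V i).T S)ᵀ * (V i).Wstar μ S θ σ * (V i).T S).PosDef ∧
    ∃ Cimp : (Fin m → Matrix (Fin d) (Fin d) ℝ) → Matrix (Fin d) (Fin d) ℝ,
      (∀ W : Fin m → Matrix (Fin d) (Fin d) ℝ, Admissible V S W →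
        -- the aggregated estimator is well defined,
        (∀ n ω, ∃! t : Fin d → ℝ, ∀ t' : Fin d → ℝ,
          impLoss V S W (fun i => impEst V S x ξ θ i n ω) t ≤
            impLoss V S W (fun i => impEst V S x ξ θ i n ω) t') ∧
        -- consistent,
        TendstoInMeasure Pr (fun n ω => aggEst V S W x ξ θ n ω) atTop (fun _ => θ) ∧
        -- asymptotically normal with covariance `Cimp W`,
        (Cimp W).PosSemidef ∧
        TendstoInDistribution
          (fun (n : ℕ) (ω : Ω) =>
            (WithLp.toLp 2 (√(n : ℝ) • (aggEst V S W x ξ θ n ω - θ)) : EuclideanSpace ℝ (Fin d)))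
          atTop (id : EuclideanSpace ℝ (Fin d) → EuclideanSpace ℝ (Fin d))
          (fun _ => Pr) (multivariateGaussian 0 (Cimp W)) ∧
        -- and its covariance dominates `C⋆`
        (Cimp W - Cstar V μ S θ σ).PosSemidef) ∧
      Cimp (fun i => ((V i).T S)ᵀ * (V i).Wstar μ S θ σ * (V i).T S) = Cstar V μ S θ σ := by
  exact mainTheorem6_general Pr d m V hcover μ S hS hmem hcov θ σ hσ hmisfit
    (gaussianReal 0 (σ ^ 2).toNNReal) (memLp_id_gaussianReal 2) integral_id_gaussianReal
    ((integral_sq_gaussianReal_zero _).trans (Real.coe_toNNReal _ (sq_nonneg σ))) x ξ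
    (fun i k => (hxξ i k).hasLaw_prod (hx i k) (hξ i k)) hindep
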